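/- **Setting.** Let $\mathfrak R=\{\emptyset\}+\mathbb R+\mathbb R^2+\cdots$ (disjoint union) be the space of finite words of real numbers, with the measure $\int h(w)\,dw=\sum_{n\ge 0}\frac1{n!}\int_{\mathbb R^n}h(t_1,\dots,t_n)\,dt_1\cdots dt_n$. Let $\mathfrak k$ be a complex Hilbert space, $B(\mathfrak k)$ its bounded operators, and $\mathcal K_s(\mathfrak R,\mathfrak k)$ the space of continuous compactly supported functions $f:\mathfrak R\to\mathfrak k$ that are symmetric (invariant under permutations of the letters). Put $(a(t)f)(w)=f(tw)$; write $w+\{t\}$ for the word $w$ with the letter $t$ added, and $v^+v'$ for the scalar product $\langle v,v'\rangle$. A function $x:\mathbb R\times\mathfrak R^3\to B(\mathfrak k)$, $(t,\sigma,\tau,\upsilon)\mapsto x_t(\sigma,\tau,\upsilon)$, symmetric in each of $\sigma,\tau,\upsilon$, is *of class $\mathcal C^0$* if it is locally integrable in norm and is continuous on the set where $t$ and all letters of $\sigma,\tau,\upsilon$ are different. It is *of class $\mathcal C^1$* if it is of class $\mathcal C^0$ and if on the same set the usual derivative $(\partial^c x)_t=\frac{d}{dt}x_t$ and the one-sided limits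 $$(R^1_\pm x)_t(\sigma,\tau,\upsilon)=x_{t\pm0}(\sigma+\{t\},\tau,\upsilon),\quad (R^0_\pm x)_t(\sigma,\tau,\upsilon)=x_{t\pm0}(\sigma,\tau+\{t\},\upsilon),\quad (R^{-1}_\pm x)_t(\sigma,\tau,\upsilon)=x_{t\pm0}(\sigma,\tau,\upsilon+\{t\})$$ exist and are of class $\mathcal C^0$. Put $D^ix=R^i_+x-R^i_-x$ for $i\in\{1,0,-1\}$. Let $\mathfrak m(\pi,\sigma_1,\tau_1,\upsilon_1,\sigma_2,\tau_2,\upsilon_2,\varrho)=\langle a_\pi a^+_{\sigma_1+\tau_1}a_{\tau_1+\upsilon_1}a^+_{\sigma_2+\tau_2}a_{\tau_2+\upsilon_2}a^+_\varrho\rangle\,\lambda_{\pi+\upsilon_1+\upsilon_2}$ for finite disjoint index sets $\pi,\dots,\varrho$. Here the vacuum expectation $\langle\cdot\rangle$ is the sum, over all bijective pairings of the annihilators with creators standing to the right of them, of the products of the point measures $\varepsilon_{t_b}(dt_c)$ over the pairs $(a_b,a^+_c)$, and $\lambda$ is Lebesgue measure in the variables $t_b$, $b\in\pi+\upsilon_1+\upsilon_2$.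 Letting the sizes of the index sets vary, with weights $1/n!$ for each of the eight words as above, $\mathfrak m$ is a measure on $\mathfrak R^8$. For $F,G:\mathfrak R^3\to B(\mathfrak k)$ and $f,g:\mathfrak R\to\mathfrak k$ put $$\langle f|\mathcal B(F,G)|g\rangle=\int f^+(\pi)\,F(\sigma_1,\tau_1,\upsilon_1)\,G(\sigma_2,\tau_2,\upsilon_2)\,g(\varrho)\,\mathfrak m(\pi,\sigma_1,\tau_1,\upsilon_1,\sigma_2,\tau_2,\upsilon_2,\varrho).$$ The form *exists in norm* if $N=\int\|f(\pi)\|\,\|F(\sigma_1,\tau_1,\upsilon_1)G(\sigma_2,\tau_2,\upsilon_2)\|\,\|g(\varrho)\|\,\mathfrak m<\infty$. For $F_t,G_t$ (and $f_t,g_t$) depending on $t\in\mathbb R$ it is *locally integrable in norm* if the corresponding $N_t$ has finite integral over every compact set of $t$; in particular, the form then exists in norm for almost all $t$. **Theorem (Itô's theorem).** Let $x_t,y_t$ be of class $\mathcal C^1$ and assume that for all $f,g\in\mathcal K_s(\mathfrak R,\mathfrak k)$ and all $$F_t\in\{x_t,\partial^cx_t,R^1_\pm x_t,R^0_\pm x_t,R^{-1}_\pm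 x_t\},\qquad G_t\in\{y_t,\partial^cy_t,R^1_\pm y_t,R^0_\pm y_t,R^{-1}_\pm y_t\}$$ the form $\langle f|\mathcal B(F_t,G_t)|g\rangle$ is locally integrable in norm. Let $f,g\in\mathcal K_s(\mathfrak R,\mathfrak k)$. Then, for all these $F_t,G_t$, including also $F_t=D^ix_t$ and $G_t=D^jy_t$, the forms $\langle f|\mathcal B(F_t,G_t)|g\rangle$, $\langle a(t)f|\mathcal B(F_t,G_t)|g\rangle$, $\langle a(t)f|\mathcal B(F_t,G_t)|a(t)g\rangle$ and $\langle f|\mathcal B(F_t,G_t)|a(t)g\rangle$ are locally integrable in norm; the function $t\mapsto\langle f|\mathcal B(x_t,y_t)|g\rangle$ is locally integrable; and its Schwartz (distributional) derivative is the locally integrable function \begin{align*}\partial\langle f|\mathcal B(x_t,y_t)|g\rangle={}&\langle f|\,\mathcal B(\partial^cx_t,y_t)+\mathcal B(x_t,\partial^cy_t)+I_{-1,1,t}\,|g\rangle\\&+\langle a(t)f|\,\mathcal B(D^1x_t,y_t)+\mathcal B(x_t,D^1y_t)+I_{0,1,t}\,|g\rangle\\&+\langle a(t)f|\,\mathcal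 B(D^0x_t,y_t)+\mathcal B(x_t,D^0y_t)+I_{0,0,t}\,|a(t)g\rangle\\&+\langle f|\,\mathcal B(D^{-1}x_t,y_t)+\mathcal B(x_t,D^{-1}y_t)+I_{-1,0,t}\,|a(t)g\rangle,\end{align*} where $I_{i,j,t}=\mathcal B(R^i_+x_t,R^j_+y_t)-\mathcal B(R^i_-x_t,R^j_-y_t)$. -/

import Mathlib

open MeasureTheory Filter Topology
open scoped ContDiff

namespace QIto

noncomputable section

/-- The space `∅ + ℝ + ℝ² + ⋯` of finite words of real numbers, with the topology and the
σ-algebra of a disjoint union. -/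
abbrev Word : Type := Σ n : ℕ, (Fin n → ℝ)

/-- The word `t w`, i.e. the point `t` is added to `w`. -/
def Word.add (t : ℝ) (w : Word) : Word := ⟨w.1 + 1, Fin.cons t w.2⟩

/-- Lebesgue measure on words: `∫ h dw = ∑ₙ (1/n!) ∫_{ℝⁿ} h(t₁,…,tₙ) dt₁⋯dtₙ`. -/
def lam : Measure Word :=
  Measure.sum fun n : ℕ =>
    ((n.factorial : ENNReal)⁻¹) • Measure.map (Sigma.mk n) (volume : Measure (Fin n → ℝ))

/-- A function of one word is symmetric if it does not depend on the order of the letters. -/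
def Symm {E : Type*} (f : Word → E) : Prop :=
  ∀ (n : ℕ) (w : Fin n → ℝ) (p : Equiv.Perm (Fin n)), f ⟨n, w ∘ p⟩ = f ⟨n, w⟩

/-- The space `𝒦_s` of symmetric continuous functions with compact support on words. -/
structure IsTest {E : Type*} [NormedAddCommGroup E] (f : Word → E) : Prop where
  symm : Symm f
  cont : Continuous f
  supp : HasCompactSupport f

/-- The annihilation operator `(a(t) f)(w) = f(t w)`. -/
def annih {E : Type*} (t : ℝ) (f : Word → E) : Word → E := fun w => f (Word.add t w)

/-! ### Functions of class `C⁰` and `C¹` -/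

/-- The set of all `(t, σ, τ, υ)` for which `t` and all the letters of `σ, τ, υ` are different. -/
def Distinct : Set (ℝ × Word × Word × Word) :=
  {z | (z.1 :: (List.ofFn z.2.1.2 ++ List.ofFn z.2.2.1.2 ++ List.ofFn z.2.2.2.2)).Nodup}

section Classes

variable {A : Type*} [NormedAddCommGroup A]

/-- Class `C⁰`: symmetric in each of the three words, locally integrable in norm with respect to
Lebesgue measure, and continuous on the set where all points are different. -/
structure IsC0 (x : ℝ → Word → Word → Word → A) : Prop where
  symm₁ : ∀ t τ υ, Symm fun σ => x t σ τ υ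
  symm₂ : ∀ t σ υ, Symm fun τ => x t σ τ υ
  symm₃ : ∀ t σ τ, Symm fun υ => x t σ τ υ
  locInt : LocallyIntegrable (fun z : ℝ × Word × Word × Word => x z.1 z.2.1 z.2.2.1 z.2.2.2)
    ((volume : Measure ℝ).prod (lam.prod (lam.prod lam)))
  cont : ContinuousOn (fun z : ℝ × Word × Word × Word => x z.1 z.2.1 z.2.2.1 z.2.2.2) Distinct

/-- Add the point `t` to the first (`i = 1`), second (`i = 0`) or third (`i = -1`) argument. -/
def addPoint (i : SignType) (t : ℝ) (F : Word → Word → Word → A) : Word → Word → Word → A :=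
  fun σ τ υ =>
    match i with
    | .pos => F (Word.add t σ) τ υ
    | .zero => F σ (Word.add t τ) υ
    | .neg => F σ τ (Word.add t υ)

/-- `(R^i_+ x)_t(σ,τ,υ)`: the value at `t + 0` of `u ↦ x_u`, with `t` added to the `i`-th
argument. -/
def Rplus (i : SignType) (x : ℝ → Word → Word → Word → A) : ℝ → Word → Word → Word → A :=
  fun t σ τ υ => limUnder (𝓝[>] t) fun u => addPoint i t (x u) σ τ υ

/-- `(R^i_- x)_t(σ,τ,υ)`: the value at `t - 0` of `u ↦ x_u`, with `t` added to the `i`-th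
argument. -/
def Rminus (i : SignType) (x : ℝ → Word → Word → Word → A) : ℝ → Word → Word → Word → A :=
  fun t σ τ υ => limUnder (𝓝[<] t) fun u => addPoint i t (x u) σ τ υ

/-- The jump `D^i x = R^i_+ x - R^i_- x`. -/
def jump (i : SignType) (x : ℝ → Word → Word → Word → A) : ℝ → Word → Word → Word → A :=
  fun t σ τ υ => Rplus i x t σ τ υ - Rminus i x t σ τ υ

variable [NormedSpace ℝ A]

/-- The usual derivative `∂^c x` with respect to `t`. -/
def dc (x : ℝ → Word → Word → Word → A) : ℝ → Word → Word → Word → A :=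
  fun t σ τ υ => deriv (fun u => x u σ τ υ) t

/-- Class `C¹`: `x` is of class `C⁰`, and where all points are different the derivative `∂^c x`
and the one-sided limits `R^i_± x` exist, and are of class `C⁰`. -/
structure IsC1 (x : ℝ → Word → Word → Word → A) : Prop where
  isC0 : IsC0 x
  diff : ∀ t σ τ υ, (t, σ, τ, υ) ∈ Distinct → DifferentiableAt ℝ (fun u => x u σ τ υ) t
  dc_isC0 : IsC0 (dc x)
  right : ∀ i t σ τ υ, (t, σ, τ, υ) ∈ Distinct →
    ∃ l, Tendsto (fun u => addPoint i t (x u) σ τ υ) (𝓝[>] t) (𝓝 l)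
  left : ∀ i t σ τ υ, (t, σ, τ, υ) ∈ Distinct →
    ∃ l, Tendsto (fun u => addPoint i t (x u) σ τ υ) (𝓝[<] t) (𝓝 l)
  right_isC0 : ∀ i, IsC0 (Rplus i x)
  left_isC0 : ∀ i, IsC0 (Rminus i x)

/-- The family `{x, ∂^c x, R^1_± x, R^0_± x, R^{-1}_± x}`. -/
def family (x : ℝ → Word → Word → Word → A) : Set (ℝ → Word → Word → Word → A) :=
  {x, dc x} ∪ Set.range (fun i => Rplus i x) ∪ Set.range (fun i => Rminus i x)

/-- The family of all functions whose forms occur in the Itô formula: `family x` and the jumps. -/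
def familyD (x : ℝ → Word → Word → Word → A) : Set (ℝ → Word → Word → Word → A) :=
  family x ∪ Set.range (fun i => jump i x)

end Classes

/-! ### Vacuum expectation of admissible monomials -/

section Vacuum

variable {ι : Type} [Finite ι]

/-- A monomial in creators `a⁺_i` and annihilators `a_i`, `i ∈ ι`, is described by the places,
counted from the left, of its factors: `ann i = some k` means that `a_i` stands at place `k`,
`ann i = none` that it does not occur; `cre` does the same for the creators. Commuting factors may
share a place.
A pairing matches every annihilator with a creator to the right of it, bijectively. -/
def Pairing (ann cre : ι → Option ℕ) : Type :=
  {e : {i // (ann i).isSome} ≃ {i // (cre i).isSome} //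
    ∀ i : {i // (ann i).isSome}, ∃ k l, ann i = some k ∧ cre (e i) = some l ∧ k < l}

/-- The components (chains) of the graph with edges `(i, j)`, `a_i` being paired with `a⁺_j`. -/
def Pairing.chains {ann cre : ι → Option ℕ} (e : Pairing ann cre) : Setoid ι :=
  Relation.EqvGen.setoid fun i j => ∃ h : (ann i).isSome, (e.1 ⟨i, h⟩).1 = j

/-- The product `∏ ε_{x_i}(dx_j)` over the edges `(i, j)` of a pairing, times Lebesgue measure in
the starting points of the chains: all variables in a chain coincide, and each chain carries
Lebesgue measure. -/
def Pairing.measure {ann cre : ι → Option ℕ} (e : Pairing ann cre) : Measure (ι → ℝ) :=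
  letI : Fintype (Quotient e.chains) := Fintype.ofFinite _
  Measure.map (fun (y : Quotient e.chains → ℝ) (i : ι) => y (Quotient.mk e.chains i)) volume

/-- The vacuum expectation `⟨M⟩ λ` of an admissible monomial: the sum over all pairings. -/
def vacuum (ann cre : ι → Option ℕ) : Measure (ι → ℝ) :=
  Measure.sum fun e : Pairing ann cre => e.measure

end Vacuum

/-- The places of the annihilators in
`a_π a⁺_{σ₁+τ₁} a_{τ₁+υ₁} a⁺_{σ₂+τ₂} a_{τ₂+υ₂} a⁺_ϱ`; the index sets
`π, σ₁, τ₁, υ₁, σ₂, τ₂, υ₂, ϱ` have the numbers `0, …, 7`. -/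
def annPlace : Fin 8 → Option ℕ :=
  ![some 0, none, some 2, some 2, none, some 4, some 4, none]

/-- The places of the creators in the same monomial. -/
def crePlace : Fin 8 → Option ℕ :=
  ![none, some 1, some 1, none, some 3, some 3, none, some 5]

/-- The measure
`𝔪(π,σ₁,τ₁,υ₁,σ₂,τ₂,υ₂,ϱ) = ⟨a_π a⁺_{σ₁+τ₁} a_{τ₁+υ₁} a⁺_{σ₂+τ₂} a_{τ₂+υ₂} a⁺_ϱ⟩ λ_{π+υ₁+υ₂}`
on eightfold words. The weights `1/n!` are those of the integral over words. -/
def mMeasure : Measure (Fin 8 → Word) :=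
  Measure.sum fun n : Fin 8 → ℕ =>
    ((∏ k, ((n k).factorial : ENNReal))⁻¹) •
      Measure.map
        (fun (s : (Σ k : Fin 8, Fin (n k)) → ℝ) (k : Fin 8) => (⟨n k, fun i => s ⟨k, i⟩⟩ : Word))
        (vacuum (fun c : Σ k : Fin 8, Fin (n k) => annPlace c.1) (fun c => crePlace c.1))

/-! ### The sesquilinear forms -/

section Forms

variable {K : Type*} [NormedAddCommGroup K] [InnerProductSpace ℂ K]

/-- The form
`⟨f|ℬ(F,G)|g⟩ = ∫ f⁺(π) F(σ₁,τ₁,υ₁) G(σ₂,τ₂,υ₂) g(ϱ) 𝔪(π,σ₁,τ₁,υ₁,σ₂,τ₂,υ₂,ϱ)`. -/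
def form (f : Word → K) (F G : Word → Word → Word → K →L[ℂ] K) (g : Word → K) : ℂ :=
  ∫ z, inner ℂ (f (z 0)) (F (z 1) (z 2) (z 3) (G (z 4) (z 5) (z 6) (g (z 7)))) ∂mMeasure

/-- The integral of the norm, `∫ ‖f(π)‖ ‖F(σ₁,τ₁,υ₁) G(σ₂,τ₂,υ₂)‖ ‖g(ϱ)‖ 𝔪`; the form
`⟨f|ℬ(F,G)|g⟩` exists in norm if this is finite. -/
def formNorm (f : Word → K) (F G : Word → Word → Word → K →L[ℂ] K) (g : Word → K) : ENNReal :=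
  ∫⁻ z, ‖f (z 0)‖ₑ * ‖F (z 1) (z 2) (z 3) ∘L G (z 4) (z 5) (z 6)‖ₑ * ‖g (z 7)‖ₑ ∂mMeasure

/-- `t ↦ ⟨f_t|ℬ(F_t,G_t)|g_t⟩` exists in norm for almost all `t` and is locally integrable in
norm. -/
def LocIntegrableInNorm (f : ℝ → Word → K) (F G : ℝ → Word → Word → Word → K →L[ℂ] K)
    (g : ℝ → Word → K) : Prop :=
  ∀ C : Set ℝ, IsCompact C → ∫⁻ t in C, formNorm (f t) (F t) (G t) (g t) < ⊤

/-- `⟨f|I_{i,j,t}|g⟩` with `I_{i,j,t} = ℬ(R^i_+ x_t, R^j_+ y_t) - ℬ(R^i_- x_t, R^j_- y_t)`. -/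
def corr (i j : SignType) (x y : ℝ → Word → Word → Word → K →L[ℂ] K) (t : ℝ)
    (f g : Word → K) : ℂ :=
  form f (Rplus i x t) (Rplus j y t) g - form f (Rminus i x t) (Rminus j y t) g

end Forms

/-- The Schwartz derivative of the locally integrable function `V` is the locally integrable
function `W`. -/
def HasSchwartzDeriv (V W : ℝ → ℂ) : Prop :=
  LocallyIntegrable V ∧ LocallyIntegrable W ∧
    ∀ φ : ℝ → ℂ, ContDiff ℝ ∞ φ → HasCompactSupport φ →
      -∫ t, V t * deriv φ t = ∫ t, W t * φ t

end

end QIto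

namespace QIto

noncomputable section

/-! A pairing in the vacuum expectation groups the letters of the eight words into chains. All
letters of a chain are the same real number, and this number carries Lebesgue measure. The factors
of the monomial form four blocks `π | σ₁ τ₁ υ₁ | σ₂ τ₂ υ₂ | ϱ`. A chain runs strictly to the right
through the blocks, starts at a letter without creator and ends at a letter without annihilator, so
the index sets that it meets form one of eleven possible sets, tabulated in `mem`. On symmetric
functions `𝔪` therefore amounts to the measure `conf` on finite sets of points, each marked by one
of eleven types, with the usual weights `1/N!` (`mMeasure_eq`, `SymmAll.lintegral_mMeasure`). This
turns the algebra of normal ordering into bookkeeping of marks.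

For a fixed configuration of different points the integrand of the form is an ordinary function of
`t`. Off the points it is differentiable, with the product rule giving the two terms in `∂^c`. At a
point of type `c` it has one-sided limits, in which that point is the new letter `t` added to the
words met by `c`: this produces `R^i_±` in neither, one or both operators, and `a(t)` on `f` or `g`
(`tendsto_right`, `tendsto_left`, `hasDerivAt_integrand`). Multiplication by a test function `φ` and
the fundamental theorem of calculus with jumps give a sum over the points of `φ` times the jump
(`integral_deriv_of_jumps`, `integral_eq_pointSum`).

Integration over configurations turns the sum over points into an integral over a point `t` and an
independent configuration (`integral_pointSum`), that is, into forms again, one difference for each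
type. Type 2 joins `π` directly to `ϱ` and has no jump. Six types meet exactly one operator and give
the terms with `D^i`; the remaining four meet both and give the Itô corrections `I_{i,j}`
(`itoDeriv_ae_eq`).

All uses of Fubini rest on local integrability in norm. It extends to `a(t) f` because one test
function dominates all `a(t) f` at once (`IsTest.exists_dominating`). -/

/-! ### Pairings and their chains -/

section Chains

variable {ι U : Type} {ann cre : ι → Option ℕ} {blk : ι → ℕ}

/-- A labelling `q` of the indices by chains: every chain is ordered strictly by the block number
`blk`, its first member is the only one that is no creator, and its last member is the only one
that is no annihilator. -/
structure IsChainMap (ann cre : ι → Option ℕ) (blk : ι → ℕ) (q : ι → U) : Prop where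
  inj : ∀ i j, q i = q j → blk i = blk j → i = j
  cre_none : ∀ i, cre i = none ↔ ∀ j, q j = q i → blk i ≤ blk j
  ann_none : ∀ i, ann i = none ↔ ∀ j, q j = q i → blk j ≤ blk i

/-- The block number orders the annihilators and creators in the same way as their places. -/
def BlockOrdered (ann cre : ι → Option ℕ) (blk : ι → ℕ) : Prop :=
  ∀ i j k l, ann i = some k → cre j = some l → (k < l ↔ blk i < blk j)

/-- The index `i` is paired with `j`. -/
def Pairing.Edge (e : Pairing ann cre) (i j : ι) : Prop :=
  ∃ h : (ann i).isSome, (e.1 ⟨i, h⟩).1 = j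

theorem Pairing.Edge.blk_lt (hb : BlockOrdered ann cre blk) {e : Pairing ann cre} {i j : ι}
    (h : e.Edge i j) : blk i < blk j := by
  obtain ⟨h, rfl⟩ := h
  obtain ⟨k, l, h1, h2, h3⟩ := e.2 ⟨i, h⟩
  exact (hb _ _ _ _ h1 h2).1 h3

theorem Pairing.edge_rightUnique (e : Pairing ann cre) : Relator.RightUnique e.Edge := by
  rintro i j k ⟨h, rfl⟩ ⟨h', rfl⟩
  rfl

theorem Pairing.edge_leftUnique (e : Pairing ann cre) : Relator.LeftUnique e.Edge := by
  rintro i j k ⟨h, h1⟩ ⟨h', h2⟩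
  have := e.1.injective (Subtype.ext (h1.trans h2.symm))
  exact congrArg Subtype.val this

theorem Pairing.reach_blk (hb : BlockOrdered ann cre blk) {e : Pairing ann cre} {i j : ι}
    (h : Relation.ReflTransGen e.Edge i j) : i = j ∨ blk i < blk j := by
  induction h with
  | refl => exact Or.inl rfl
  | tail _ h ih =>
    have := Pairing.Edge.blk_lt hb h
    rcases ih with rfl | ih
    · exact Or.inr this
    · exact Or.inr (ih.trans this)

/-- Each index has at most one outgoing and one incoming edge, so two paths with a common start or a
common end are comparable. Hence the symmetric closure of reachability is already transitive. -/
theorem Pairing.chains_iff (e : Pairing ann cre) (i j : ι) : e.chains i j ↔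
    (Relation.ReflTransGen e.Edge i j ∨ Relation.ReflTransGen e.Edge j i) := by
  constructor
  · intro h
    change Relation.EqvGen e.Edge i j at h
    induction h with
    | rel _ _ h => exact Or.inl (.single h)
    | refl _ => exact Or.inl .refl
    | symm _ _ _ ih => exact ih.symm
    | trans a b c _ _ ih1 ih2 =>
      rcases ih1 with h1 | h1 <;> rcases ih2 with h2 | h2
      · exact Or.inl (h1.trans h2)
      · have := Relation.ReflTransGen.total_of_right_unique
          (r := Function.swap e.Edge) (fun x y z h h' => e.edge_leftUnique h h')
          (Relation.reflTransGen_swap.2 h1) (Relation.reflTransGen_swap.2 h2)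
        exact this.symm.imp Relation.reflTransGen_swap.1 Relation.reflTransGen_swap.1
      · exact Relation.ReflTransGen.total_of_right_unique e.edge_rightUnique h1 h2
      · exact Or.inr (h2.trans h1)
  · have key : ∀ {i j}, Relation.ReflTransGen e.Edge i j → Relation.EqvGen e.Edge i j := by
      intro i j h
      induction h with
      | refl => exact .refl _
      | tail _ h ih => exact .trans _ _ _ ih (.rel _ _ h)
    rintro (h | h)
    · exact key h
    · exact (key h).symm

theorem Pairing.mk_eq_iff (e : Pairing ann cre) (i j : ι) :
    (Quotient.mk e.chains i = Quotient.mk e.chains j) ↔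
    (Relation.ReflTransGen e.Edge i j ∨ Relation.ReflTransGen e.Edge j i) := by
  rw [← e.chains_iff]
  exact Quotient.eq (r := e.chains)

theorem Pairing.isChainMap (hb : BlockOrdered ann cre blk) (e : Pairing ann cre) :
    IsChainMap ann cre blk (Quotient.mk e.chains) where
  inj i j h hij := by
    rcases (e.mk_eq_iff i j).1 h with h | h <;> rcases Pairing.reach_blk hb h with h | h
    · exact h
    · omega
    · exact h.symm
    · omega
  cre_none i := by
    constructor
    · intro hi j hj
      rcases (e.mk_eq_iff j i).1 hj with h | h
      · rcases Relation.ReflTransGen.cases_tail h with h | ⟨k, _, hk, h⟩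
        · rw [h]
        · have := (e.1 ⟨k, hk⟩).2
          rw [h, hi] at this
          simp at this
      · rcases Pairing.reach_blk hb h with h | h
        · rw [h]
        · exact h.le
    · intro h
      by_contra hi
      have hi : (cre i).isSome := Option.isSome_iff_ne_none.2 hi
      have hE : e.Edge (e.1.symm ⟨i, hi⟩).1 i := ⟨(e.1.symm ⟨i, hi⟩).2, by simp⟩
      have h1 := h _ ((e.mk_eq_iff _ _).2 (Or.inl (.single hE)))
      have := Pairing.Edge.blk_lt hb hE
      omega
  ann_none i := by
    constructor
    · intro hi j hj
      rcases (e.mk_eq_iff j i).1 hj with h | h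
      · rcases Pairing.reach_blk hb h with h | h
        · rw [h]
        · exact h.le
      · rcases Relation.ReflTransGen.cases_head h with h | ⟨k, ⟨hk, h⟩, _⟩
        · rw [h]
        · rw [hi] at hk
          simp at hk
    · intro h
      by_contra hi
      have hi : (ann i).isSome := Option.isSome_iff_ne_none.2 hi
      have hE : e.Edge i (e.1 ⟨i, hi⟩).1 := ⟨hi, rfl⟩
      have h1 := h _ ((e.mk_eq_iff _ _).2 (Or.inr (.single hE)))
      have := Pairing.Edge.blk_lt hb hE
      omega

/-- The partner of `i` is the next member of its chain in block order. This is what allows a pairing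
to be recovered from its chains. -/
theorem Pairing.edge_min (hb : BlockOrdered ann cre blk) {e : Pairing ann cre} {i j k : ι}
    (h : e.Edge i j) (hk : Quotient.mk e.chains k = Quotient.mk e.chains i)
    (hik : blk i < blk k) : blk j ≤ blk k := by
  rcases (e.mk_eq_iff k i).1 hk with h' | h'
  · rcases Pairing.reach_blk hb h' with rfl | h'
    · omega
    · omega
  · rcases Relation.ReflTransGen.cases_head h' with h' | ⟨j', hj', h'⟩
    · rw [h'] at hik
      omega
    · rw [e.edge_rightUnique h hj']
      rcases Pairing.reach_blk hb h' with rfl | h'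
      · rfl
      · exact h'.le

/-- By `Pairing.edge_min` both partners of `i` are the earliest later member of the same class, and
a class has at most one member in each block. -/
theorem Pairing.ext_of_ker (hb : BlockOrdered ann cre blk) {e e' : Pairing ann cre}
    (h : ∀ i j, Quotient.mk e.chains i = Quotient.mk e.chains j ↔
      Quotient.mk e'.chains i = Quotient.mk e'.chains j) : e = e' := by
  apply Subtype.ext
  apply Equiv.ext
  rintro ⟨i, hi⟩
  apply Subtype.ext
  have hE : e.Edge i (e.1 ⟨i, hi⟩).1 := ⟨hi, rfl⟩
  have hE' : e'.Edge i (e'.1 ⟨i, hi⟩).1 := ⟨hi, rfl⟩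
  have h1 := (e.mk_eq_iff _ _).2 (Or.inr (.single hE))
  have h2 := (e'.mk_eq_iff _ _).2 (Or.inr (.single hE'))
  have h3 := Pairing.edge_min hb hE ((h _ _).2 h2) (hE'.blk_lt hb)
  have h4 := Pairing.edge_min hb hE' ((h _ _).1 h1) (hE.blk_lt hb)
  exact (e.isChainMap hb).inj _ _ (h1.trans ((h _ _).2 h2).symm) (le_antisymm h3 h4)

namespace IsChainMap

variable {q : ι → U}

/-- `j` follows directly after `i` in its chain. -/
def Next (blk : ι → ℕ) (q : ι → U) (i j : ι) : Prop :=
  q j = q i ∧ blk i < blk j ∧ ∀ k, q k = q i → blk i < blk k → blk j ≤ blk k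

theorem exists_next (h : IsChainMap ann cre blk q) (i : {i // (ann i).isSome}) :
    ∃ j : {j // (cre j).isSome}, Next blk q i j := by
  classical
  obtain ⟨i, hi⟩ := i
  have h1 : ∃ j, q j = q i ∧ blk i < blk j := by
    have := mt (h.ann_none i).2 (Option.isSome_iff_ne_none.1 hi)
    push Not at this
    exact this
  have h2 : ∃ n, ∃ j, q j = q i ∧ blk i < blk j ∧ blk j = n :=
    ⟨_, h1.choose, h1.choose_spec.1, h1.choose_spec.2, rfl⟩
  obtain ⟨j, hj1, hj2, hj3⟩ := Nat.find_spec h2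
  refine ⟨⟨j, Option.isSome_iff_ne_none.2 fun hc => ?_⟩, hj1, hj2, fun k hk hik => ?_⟩
  · have := (h.cre_none j).1 hc i hj1.symm
    omega
  · show blk j ≤ blk k
    rw [hj3]
    exact Nat.find_min' h2 ⟨k, hk, hik, rfl⟩

theorem next_unique (h : IsChainMap ann cre blk q) {i j k : ι}
    (hj : Next blk q i j) (hk : Next blk q i k) : j = k :=
  h.inj _ _ (hj.1.trans hk.1.symm)
    (le_antisymm (hj.2.2 _ hk.1 hk.2.1) (hk.2.2 _ hj.1 hj.2.1))

/-- The map that takes an annihilator to the next index in its chain. -/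
def next (h : IsChainMap ann cre blk q) (i : {i // (ann i).isSome}) : {j // (cre j).isSome} :=
  (h.exists_next i).choose

theorem next_spec (h : IsChainMap ann cre blk q) (i : {i // (ann i).isSome}) :
    Next blk q i (h.next i) :=
  (h.exists_next i).choose_spec

theorem next_bijective (h : IsChainMap ann cre blk q) : Function.Bijective h.next := by
  classical
  constructor
  · intro i i' hii
    have h1 := h.next_spec i
    have h2 := h.next_spec i'
    rw [← hii] at h2
    have hq : q i = q i' := h1.1.symm.trans h2.1
    apply Subtype.ext
    apply h.inj _ _ hq
    rcases lt_trichotomy (blk i.1) (blk i'.1) with hl | hl | hl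
    · have := h1.2.2 _ hq.symm hl
      have := h2.2.1
      omega
    · exact hl
    · have := h2.2.2 _ hq hl
      have := h1.2.1
      omega
  · rintro ⟨j, hj⟩
    have h1 : ∃ i, q i = q j ∧ blk i < blk j := by
      have := mt (h.cre_none j).2 (Option.isSome_iff_ne_none.1 hj)
      push Not at this
      exact this
    -- Minimising the gap selects the latest member of the chain before `j`; its successor must be
    -- `j`.
    have h2 : ∃ n, ∃ i, q i = q j ∧ blk i < blk j ∧ blk j - blk i = n :=
      ⟨_, h1.choose, h1.choose_spec.1, h1.choose_spec.2, rfl⟩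
    obtain ⟨i, hi1, hi2, hi3⟩ := Nat.find_spec h2
    have hi : (ann i).isSome := Option.isSome_iff_ne_none.2 fun hc => by
      have := (h.ann_none i).1 hc j hi1.symm
      omega
    refine ⟨⟨i, hi⟩, Subtype.ext (h.next_unique (h.next_spec ⟨i, hi⟩) ⟨hi1.symm, hi2, ?_⟩)⟩
    intro k hk hik
    by_contra hkj
    have := Nat.find_min' h2 ⟨k, hk.trans hi1, not_le.1 hkj, rfl⟩
    simp only [] at hik
    omega

/-- The pairing with given chains. -/
def pairing (hb : BlockOrdered ann cre blk) (h : IsChainMap ann cre blk q) : Pairing ann cre :=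
  ⟨Equiv.ofBijective h.next h.next_bijective, fun i => by
    obtain ⟨k, hk⟩ := Option.isSome_iff_exists.1 i.2
    obtain ⟨l, hl⟩ := Option.isSome_iff_exists.1 (h.next i).2
    exact ⟨k, l, hk, hl, (hb _ _ _ _ hk hl).2 (h.next_spec i).2.1⟩⟩

theorem pairing_edge (hb : BlockOrdered ann cre blk) (h : IsChainMap ann cre blk q) {i j : ι}
    (hE : (h.pairing hb).Edge i j) : q i = q j := by
  obtain ⟨hi, rfl⟩ := hE
  exact (h.next_spec ⟨i, hi⟩).1.symm

theorem exists_start (hb : BlockOrdered ann cre blk) (e : Pairing ann cre) (i : ι) :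
    ∃ j, Quotient.mk e.chains j = Quotient.mk e.chains i ∧ cre j = none := by
  induction hn : blk i using Nat.strong_induction_on generalizing i with
  | _ n ih =>
    subst hn
    by_cases hc : cre i = none
    · exact ⟨i, rfl, hc⟩
    · have := mt ((e.isChainMap hb).cre_none i).2 hc
      push Not at this
      obtain ⟨k, hk, hki⟩ := this
      obtain ⟨j, hj, hj'⟩ := ih _ hki k rfl
      exact ⟨j, hj.trans hk, hj'⟩

/-- Edges stay inside a class of `q`. Conversely, a class cannot split into several chains: each
chain has a start without creator, and by `cre_none` such a start is the block-minimal element of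
the whole class, hence unique. -/
theorem pairing_mk_eq_iff (hb : BlockOrdered ann cre blk) (h : IsChainMap ann cre blk q)
    (i j : ι) : Quotient.mk (h.pairing hb).chains i = Quotient.mk (h.pairing hb).chains j ↔
      q i = q j := by
  have key : ∀ {i j}, Quotient.mk (h.pairing hb).chains i = Quotient.mk (h.pairing hb).chains j →
      q i = q j := by
    have aux : ∀ {i j}, Relation.ReflTransGen (h.pairing hb).Edge i j → q i = q j := by
      intro i j hr
      induction hr with
      | refl => rfl
      | tail _ h' ih => exact ih.trans (h.pairing_edge hb h')
    intro i j hij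
    rcases ((h.pairing hb).mk_eq_iff i j).1 hij with hr | hr
    · exact aux hr
    · exact (aux hr).symm
  refine ⟨key, fun hq => ?_⟩
  obtain ⟨i', hi, hi'⟩ := exists_start hb (h.pairing hb) i
  obtain ⟨j', hj, hj'⟩ := exists_start hb (h.pairing hb) j
  have hq' : q i' = q j' := (key hi).trans (hq.trans (key hj).symm)
  have : i' = j' := h.inj _ _ hq'
    (le_antisymm ((h.cre_none i').1 hi' _ hq'.symm) ((h.cre_none j').1 hj' _ hq'))
  rw [← hi, ← hj, this]

end IsChainMap

end Chains

/-! ### The eleven types of chains -/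

/-- The block of an index set: `π | σ₁ τ₁ υ₁ | σ₂ τ₂ υ₂ | ϱ`. -/
def block : Fin 8 → ℕ := ![0, 1, 1, 1, 2, 2, 2, 3]

/-- The types of chains: `mem c k` tells whether a chain of type `c` meets the index set `k`. -/
def mem : Fin 11 → Fin 8 → Bool :=
  ![![true, true, false, false, false, false, false, false],
    ![true, false, false, false, true, false, false, false],
    ![true, false, false, false, false, false, false, true],
    ![true, false, true, false, true, false, false, false],
    ![true, false, true, false, false, true, false, true],
    ![true, false, true, false, false, false, false, true],
    ![true, false, false, false, false, true, false, true],
    ![false, false, false, true, true, false, false, false],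
    ![false, false, false, true, false, true, false, true],
    ![false, false, false, true, false, false, false, true],
    ![false, false, false, false, false, false, true, true]]

/-- The property of a set of index sets to be met by a chain. -/
def IsType (o : Fin 8 → Bool) : Prop :=
  (∃ k, o k) ∧ (∀ k l, o k → o l → block k = block l → k = l) ∧
    (∀ k, o k → (crePlace k = none ↔ ∀ l, o l → block k ≤ block l)) ∧
    (∀ k, o k → (annPlace k = none ↔ ∀ l, o l → block l ≤ block k))

instance : DecidablePred IsType := fun o => by unfold IsType; infer_instance

theorem isType_mem : ∀ c, IsType (mem c) := by decide

theorem mem_injective : Function.Injective mem := by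
  intro c d
  revert c d
  decide

-- Completeness of the table of types, by inspection of all 256 subsets of the eight index sets.
set_option maxRecDepth 100000 in
theorem exists_mem_eq_aux : ∀ a b c d e f g h : Bool, IsType ![a, b, c, d, e, f, g, h] →
    ∃ t, mem t = ![a, b, c, d, e, f, g, h] := by
  decide

theorem exists_mem_eq (o : Fin 8 → Bool) (ho : IsType o) : ∃ c, mem c = o := by
  have : o = ![o 0, o 1, o 2, o 3, o 4, o 5, o 6, o 7] := by
    ext k; fin_cases k <;> rfl
  rw [this] at ho ⊢
  exact exists_mem_eq_aux _ _ _ _ _ _ _ _ ho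

theorem exists_mem (c : Fin 11) : ∃ k, mem c k := (isType_mem c).1

theorem block_lt_iff : ∀ k l : Fin 8, ∀ a ∈ annPlace k, ∀ b ∈ crePlace l,
    (a < b ↔ block k < block l) := by decide

/-! ### Labelled pairings and arrangements of words -/

/-- The letters of eight words of lengths `n k`. -/
abbrev Letters (n : Fin 8 → ℕ) : Type := Σ k : Fin 8, Fin (n k)

/-- The pairings of the monomial that defines `𝔪`, for words of lengths `n k`. -/
abbrev WordPairing (n : Fin 8 → ℕ) : Type :=
  Pairing (fun c : Letters n => annPlace c.1) (fun c => crePlace c.1)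

theorem blockOrdered (n : Fin 8 → ℕ) : BlockOrdered (fun c : Letters n => annPlace c.1)
    (fun c => crePlace c.1) (fun c => block c.1) :=
  fun _ _ _ _ hk hl => block_lt_iff _ _ _ hk _ hl

/-- The chains meeting the index set `k`, if the chain `u` has the type `c u`. -/
abbrev Meet {N : ℕ} (c : Fin N → Fin 11) (k : Fin 8) : Type := {u // mem (c u) k = true}

/-- `N` chains of given types, together with an order of those that meet the index set `k`. -/
abbrev Arrangement (n : Fin 8 → ℕ) (N : ℕ) : Type :=
  Σ c : Fin N → Fin 11, ∀ k, Fin (n k) ≃ Meet c k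

/-- Pairings with numbered chains. -/
abbrev LabelledPairing (n : Fin 8 → ℕ) (N : ℕ) : Type :=
  Σ e : WordPairing n, (Quotient e.chains ≃ Fin N)

namespace Arrangement

variable {n : Fin 8 → ℕ} {N : ℕ}

/-- The number of the chain of a letter. -/
def label (x : Arrangement n N) (i : Letters n) : Fin N := (x.2 i.1 i.2).1

theorem mem_label (x : Arrangement n N) (i : Letters n) : mem (x.1 (x.label i)) i.1 = true :=
  (x.2 i.1 i.2).2

theorem exists_label (x : Arrangement n N) {u : Fin N} {k : Fin 8} (h : mem (x.1 u) k = true) :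
    ∃ i, x.label ⟨k, i⟩ = u :=
  ⟨(x.2 k).symm ⟨u, h⟩, by simp [label]⟩

theorem isChainMap (x : Arrangement n N) : IsChainMap (fun c : Letters n => annPlace c.1)
    (fun c => crePlace c.1) (fun c => block c.1) x.label where
  inj i j h hb := by
    have hi := x.mem_label i
    have hj := x.mem_label j
    rw [← h] at hj
    have hk := (isType_mem _).2.1 _ _ hi hj hb
    obtain ⟨k, i⟩ := i
    obtain ⟨l, j⟩ := j
    obtain rfl : k = l := hk
    have := (x.2 k).injective (Subtype.ext h)
    exact congrArg (Sigma.mk k) this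
  cre_none i := by
    rw [(isType_mem _).2.2.1 _ (x.mem_label i)]
    constructor
    · intro h j hj
      exact h _ (hj ▸ x.mem_label j)
    · intro h l hl
      obtain ⟨a, ha⟩ := x.exists_label hl
      exact h _ ha
  ann_none i := by
    rw [(isType_mem _).2.2.2 _ (x.mem_label i)]
    constructor
    · intro h j hj
      exact h _ (hj ▸ x.mem_label j)
    · intro h l hl
      obtain ⟨a, ha⟩ := x.exists_label hl
      exact h _ ha

/-- The numbered pairing with the chains of an arrangement. -/
def toLabelled (x : Arrangement n N) : LabelledPairing n N :=
  ⟨x.isChainMap.pairing (blockOrdered n), Equiv.ofBijective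
    (Quotient.lift x.label fun i j h =>
      (x.isChainMap.pairing_mk_eq_iff (blockOrdered n) i j).1 (Quotient.sound h)) (by
    constructor
    · intro a b
      induction a using Quotient.inductionOn
      induction b using Quotient.inductionOn
      exact (x.isChainMap.pairing_mk_eq_iff (blockOrdered n) _ _).2
    · intro u
      obtain ⟨k, hk⟩ := exists_mem (x.1 u)
      obtain ⟨i, hi⟩ := x.exists_label hk
      exact ⟨Quotient.mk _ ⟨k, i⟩, hi⟩)⟩

theorem toLabelled_apply (x : Arrangement n N) (i : Letters n) :
    x.toLabelled.2 (Quotient.mk _ i) = x.label i := rfl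

/-- The type of a chain is the set of index sets in which its label occurs, and `mem` is injective,
so the labels determine the types as well as the orders. -/
theorem ext_label {x y : Arrangement n N} (h : ∀ i, x.label i = y.label i) : x = y := by
  obtain ⟨c, b⟩ := x
  obtain ⟨d, b'⟩ := y
  have hcd : c = d := by
    funext u
    apply mem_injective
    funext k
    rw [Bool.eq_iff_iff]
    constructor
    · intro hu
      obtain ⟨i, rfl⟩ := exists_label ⟨c, b⟩ hu
      rw [h]
      exact mem_label ⟨d, b'⟩ _
    · intro hu
      obtain ⟨i, rfl⟩ := exists_label ⟨d, b'⟩ hu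
      rw [← h]
      exact mem_label ⟨c, b⟩ _
  subst hcd
  congr 1
  funext k
  ext i
  exact congrArg Fin.val (h ⟨k, i⟩)

theorem toLabelled_injective : Function.Injective (toLabelled (n := n) (N := N)) := by
  intro x y h
  apply ext_label
  intro i
  rw [← toLabelled_apply, ← toLabelled_apply, h]

theorem toLabelled_surjective : Function.Surjective (toLabelled (n := n) (N := N)) := by
  rintro ⟨e, l⟩
  let q : Letters n → Fin N := fun i => l (Quotient.mk _ i)
  have hq : ∀ i j, q i = q j ↔ Quotient.mk e.chains i = Quotient.mk e.chains j :=
    fun i j => l.injective.eq_iff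
  have hC := e.isChainMap (blockOrdered n)
  have hsurj : ∀ u, ∃ i, q i = u := fun u => by
    obtain ⟨i, hi⟩ := Quotient.exists_rep (l.symm u)
    exact ⟨i, by simp [q, hi]⟩
  -- The type of a chain is read off from the index sets that it meets; the clauses of `IsType` are
  -- those of `IsChainMap` restricted to one chain.
  have hT : ∀ u, IsType fun k => decide (∃ i, q ⟨k, i⟩ = u) := by
    intro u
    refine ⟨?_, ?_, ?_, ?_⟩
    · obtain ⟨⟨k, i⟩, hi⟩ := hsurj u
      exact ⟨k, by simpa using ⟨i, hi⟩⟩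
    · simp only [decide_eq_true_eq]
      rintro k l ⟨i, hi⟩ ⟨j, hj⟩ hkl
      exact congrArg Sigma.fst (hC.inj ⟨k, i⟩ ⟨l, j⟩ ((hq _ _).1 (hi.trans hj.symm)) hkl)
    · simp only [decide_eq_true_eq]
      rintro k ⟨i, hi⟩
      rw [hC.cre_none ⟨k, i⟩]
      constructor
      · rintro h l ⟨j, hj⟩
        exact h ⟨l, j⟩ ((hq _ _).1 (hj.trans hi.symm))
      · rintro h ⟨l, j⟩ hj
        exact h l ⟨j, ((hq _ _).2 hj).trans hi⟩
    · simp only [decide_eq_true_eq]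
      rintro k ⟨i, hi⟩
      rw [hC.ann_none ⟨k, i⟩]
      constructor
      · rintro h l ⟨j, hj⟩
        exact h ⟨l, j⟩ ((hq _ _).1 (hj.trans hi.symm))
      · rintro h ⟨l, j⟩ hj
        exact h l ⟨j, ((hq _ _).2 hj).trans hi⟩
  choose c hc using fun u => exists_mem_eq _ (hT u)
  have hc' : ∀ u k, mem (c u) k = true ↔ ∃ i, q ⟨k, i⟩ = u := fun u k => by
    rw [hc u, decide_eq_true_eq]
  let x : Arrangement n N := ⟨c, fun k => Equiv.ofBijective
    (fun i => (⟨q ⟨k, i⟩, (hc' _ _).2 ⟨i, rfl⟩⟩ : Meet c k)) (by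
      constructor
      · intro i j hij
        have := hC.inj ⟨k, i⟩ ⟨k, j⟩ ((hq _ _).1 (congrArg Subtype.val hij)) rfl
        simpa using this
      · rintro ⟨u, hu⟩
        obtain ⟨i, hi⟩ := (hc' _ _).1 hu
        exact ⟨i, Subtype.ext hi⟩)⟩
  have hx : ∀ i, x.label i = q i := fun i => rfl
  refine ⟨x, ?_⟩
  have he : x.toLabelled.1 = e := by
    apply Pairing.ext_of_ker (blockOrdered n)
    intro i j
    rw [← hq, ← hx, ← hx]
    exact x.isChainMap.pairing_mk_eq_iff (blockOrdered n) i j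
  have hl : ∀ i, x.toLabelled.2 (Quotient.mk _ i) = l (Quotient.mk _ i) := fun i => rfl
  generalize x.toLabelled = z at he hl
  obtain ⟨e', l'⟩ := z
  obtain rfl : e' = e := he
  congr 1
  apply Equiv.ext
  intro a
  induction a using Quotient.inductionOn
  exact hl _

/-- Arrangements are the same as numbered pairings. -/
def equivLabelled (n : Fin 8 → ℕ) (N : ℕ) : Arrangement n N ≃ LabelledPairing n N :=
  Equiv.ofBijective toLabelled ⟨toLabelled_injective, toLabelled_surjective⟩

end Arrangement

theorem measurable_sigma_mk {α : Type*} {β : α → Type*} [∀ a, MeasurableSpace (β a)] (a : α) :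
    Measurable (fun w : β a => (⟨a, w⟩ : Sigma β)) :=
  fun s hs => by
    rw [MeasurableSpace.measurableSet_iInf] at hs
    exact hs a

/-! ### The measure `𝔪` as a sum over arrangements -/

/-- Only `N = |Q|` admits bijections, and its `N!` numberings contribute equally. This replaces the
chains of a varying pairing by the fixed index set `Fin N`. -/
theorem volume_eq_tsum_labels {Q : Type} [Fintype Q] (A : Set (Q → ℝ)) :
    volume A = ∑' (N : ℕ) (l : Q ≃ Fin N),
      (N.factorial : ENNReal)⁻¹ * volume {y : Fin N → ℝ | y ∘ l ∈ A} := by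
  classical
  have h1 : ∀ (N : ℕ) (l : Q ≃ Fin N), volume {y : Fin N → ℝ | y ∘ l ∈ A} = volume A := by
    intro N l
    have := (volume_measurePreserving_piCongrLeft (fun _ : Q => ℝ) l.symm).measure_preimage_equiv A
    rw [← this]
    congr 1
    ext y
    have : y ∘ l = MeasurableEquiv.piCongrLeft (fun _ : Q => ℝ) l.symm y := by
      funext i
      have := MeasurableEquiv.piCongrLeft_apply_apply l.symm (β := fun _ => ℝ) y (l i)
      simpa using this.symm
    change _ ∈ A ↔ _ ∈ A
    rw [this]
  rw [tsum_eq_single (Fintype.card Q)]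
  · simp only [h1, tsum_fintype, Finset.sum_const, Finset.card_univ, nsmul_eq_mul]
    rw [Fintype.card_equiv (Fintype.equivFin Q), ← mul_assoc, ENNReal.mul_inv_cancel, one_mul]
    · simp [Nat.factorial_ne_zero]
    · simp
  · intro N hN
    have : IsEmpty (Q ≃ Fin N) := ⟨fun l => hN (by simpa using (Fintype.card_congr l).symm)⟩
    simp

/-- The words spelled by `N` points in the order given by an arrangement. -/
def Arrangement.words {n : Fin 8 → ℕ} {N : ℕ} (x : Arrangement n N) (y : Fin N → ℝ)
    (k : Fin 8) : Word :=
  ⟨n k, fun i => y (x.2 k i).1⟩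

theorem Arrangement.measurable_words {n : Fin 8 → ℕ} {N : ℕ} (x : Arrangement n N) :
    Measurable x.words := by
  refine measurable_pi_lambda _ fun k => (measurable_sigma_mk _).comp ?_
  exact measurable_pi_lambda _ fun i => measurable_pi_apply _

theorem mMeasure_eq : mMeasure = Measure.sum fun z : (Σ n : Fin 8 → ℕ, Σ N, Arrangement n N) =>
    ((∏ k, ((z.1 k).factorial : ENNReal))⁻¹ * (z.2.1.factorial : ENNReal)⁻¹) •
      Measure.map z.2.2.words volume := by
  ext s hs
  rw [mMeasure, Measure.sum_apply _ hs, Measure.sum_apply _ hs, ENNReal.tsum_sigma']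
  congr 1
  funext n
  rw [Measure.smul_apply, ENNReal.tsum_sigma', Measure.map_apply _ hs]
  swap
  · refine measurable_pi_lambda _ fun k => (measurable_sigma_mk _).comp ?_
    exact measurable_pi_lambda _ fun i => measurable_pi_apply _
  have hms : MeasurableSet ((fun (s : Letters n → ℝ) (k : Fin 8) =>
      (⟨n k, fun i => s ⟨k, i⟩⟩ : Word)) ⁻¹' s) := by
    refine hs.preimage (measurable_pi_lambda _ fun k => (measurable_sigma_mk _).comp ?_)
    exact measurable_pi_lambda _ fun i => measurable_pi_apply _
  rw [vacuum, Measure.sum_apply _ hms]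
  have h1 : ∀ e : WordPairing n, e.measure ((fun (s : Letters n → ℝ) (k : Fin 8) =>
      (⟨n k, fun i => s ⟨k, i⟩⟩ : Word)) ⁻¹' s) = ∑' (N : ℕ) (l : Quotient e.chains ≃ Fin N),
      (N.factorial : ENNReal)⁻¹ * volume {y : Fin N → ℝ |
        (fun k => (⟨n k, fun i => y (l (Quotient.mk _ ⟨k, i⟩))⟩ : Word)) ∈ s} := by
    intro e
    let _ : Fintype (Quotient e.chains) := Fintype.ofFinite _
    rw [Pairing.measure, Measure.map_apply (measurable_pi_lambda _ fun i => measurable_pi_apply _)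
      hms, volume_eq_tsum_labels]
    rfl
  simp_rw [h1]
  -- With `N` outermost, the pairs of a pairing and a numbering of its chains form `LabelledPairing
  -- n N`, to which `Arrangement.equivLabelled` applies.
  rw [ENNReal.tsum_comm, smul_eq_mul, ← ENNReal.tsum_mul_left]
  congr 1
  funext N
  rw [← ENNReal.tsum_sigma' (fun z : LabelledPairing n N => (N.factorial : ENNReal)⁻¹ *
    volume {y : Fin N → ℝ |
        (fun k => (⟨n k, fun i => y (z.2 (Quotient.mk _ ⟨k, i⟩))⟩ : Word)) ∈ s}),
    ← (Arrangement.equivLabelled n N).tsum_eq, ← ENNReal.tsum_mul_left]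
  congr 1
  funext x
  rw [Measure.smul_apply, Measure.map_apply x.measurable_words hs, smul_eq_mul, mul_assoc]
  rfl

/-! ### Configurations of chains -/

/-- Finitely many points of the line, each of them marked by a type of chains. -/
abbrev Conf : Type := Σ a : (Σ N : ℕ, Fin N → Fin 11), (Fin a.1 → ℝ)

/-- The measure on marked configurations: Lebesgue measure with the weights `1/N!`. -/
def conf : Measure Conf :=
  Measure.sum fun a => (a.1.factorial : ENNReal)⁻¹ • Measure.map (Sigma.mk a) volume

instance : SFinite conf := by unfold conf; infer_instance

/-- The arrangement of chains of given types in their natural order. -/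
def stdArr {N : ℕ} (c : Fin N → Fin 11) : Arrangement (fun k => Fintype.card (Meet c k)) N :=
  ⟨c, fun k => (Fintype.equivFin (Meet c k)).symm⟩

/-- The eight words `π, σ₁, τ₁, υ₁, σ₂, τ₂, υ₂, ϱ` of a configuration. -/
def Conf.words (w : Conf) : Fin 8 → Word := (stdArr w.1.2).words w.2

theorem measurable_sigma_iff {α γ : Type*} {β : α → Type*} [∀ a, MeasurableSpace (β a)]
    [MeasurableSpace γ] {f : Sigma β → γ} (h : ∀ a, Measurable fun b : β a => f ⟨a, b⟩) :
    Measurable f := by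
  intro s hs
  rw [MeasurableSpace.measurableSet_iInf]
  exact fun a => h a hs

theorem measurableEmbedding_sigma_mk {α : Type*} {β : α → Type*} [∀ a, MeasurableSpace (β a)]
    (a : α) : MeasurableEmbedding (Sigma.mk a : β a → Sigma β) where
  injective := sigma_mk_injective
  measurable := measurable_sigma_mk a
  measurableSet_image' s hs := by
    rw [MeasurableSpace.measurableSet_iInf]
    intro b
    change MeasurableSet (Sigma.mk b ⁻¹' (Sigma.mk a '' s))
    by_cases h : b = a
    · subst h
      rwa [Set.preimage_image_eq _ sigma_mk_injective]
    · convert MeasurableSet.empty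
      ext w
      simp [Ne.symm h]

theorem measurableEmbedding_of_comp {α β γ : Type*} [MeasurableSpace α] [MeasurableSpace β]
    [MeasurableSpace γ] {f : α → β} {g : β → γ} (hf : Measurable f) (hg : Measurable g)
    (hi : Function.Injective g) (h : MeasurableEmbedding (g ∘ f)) : MeasurableEmbedding f where
  injective := h.injective.of_comp
  measurable := hf
  measurableSet_image' s hs := by
    have := hg (h.measurableSet_image' hs)
    rwa [Set.image_comp, Set.preimage_image_eq _ hi] at this

/-- A word as a sequence of numbers, continued by zeros, together with its length. -/
def Word.toSeq (w : Word) : ℕ × (ℕ → ℝ) :=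
  (w.1, fun i => if h : i < w.1 then w.2 ⟨i, h⟩ else 0)

theorem Word.toSeq_injective : Function.Injective Word.toSeq := by
  rintro ⟨n, v⟩ ⟨m, w⟩ h
  obtain rfl : n = m := congrArg Prod.fst h
  congr 1
  funext i
  have := congrFun (congrArg Prod.snd h) i
  simpa [Word.toSeq] using this

theorem Word.measurable_toSeq : Measurable Word.toSeq := by
  refine measurable_sigma_iff (β := fun n => Fin n → ℝ) fun n => measurable_const.prodMk ?_
  refine measurable_pi_lambda _ fun i => ?_
  by_cases h : i < n
  · simpa [h] using measurable_pi_apply (⟨i, h⟩ : Fin n)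
  · simp [h]

theorem Arrangement.words_injective {n : Fin 8 → ℕ} {N : ℕ} (x : Arrangement n N) :
    Function.Injective x.words := by
  intro y z h
  funext u
  obtain ⟨k, hk⟩ := exists_mem (x.1 u)
  obtain ⟨i, rfl⟩ := x.exists_label hk
  have := congrFun h k
  simp only [Arrangement.words, Sigma.mk.injEq, heq_eq_eq, true_and] at this
  exact congrFun this i

/-- Encoding words as sequences reduces the claim to an injective measurable map between products of
standard spaces, where it is the Lusin–Souslin theorem. With embeddings, changes of variables need
no measurability of the integrand. -/
theorem Arrangement.measurableEmbedding_words {n : Fin 8 → ℕ} {N : ℕ} (x : Arrangement n N) :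
    MeasurableEmbedding x.words := by
  have hg : Measurable fun (z : Fin 8 → Word) k => (z k).toSeq :=
    measurable_pi_lambda _ fun k => Word.measurable_toSeq.comp (measurable_pi_apply k)
  have hi : Function.Injective fun (z : Fin 8 → Word) k => (z k).toSeq := by
    intro z z' h
    funext k
    exact Word.toSeq_injective (congrFun h k)
  exact measurableEmbedding_of_comp x.measurable_words hg hi
    ((hg.comp x.measurable_words).measurableEmbedding (hi.comp x.words_injective))

/-! ### Integrals of symmetric functions -/

/-- Two words that differ only by the order of their letters. -/
def Word.Same (w w' : Word) : Prop := ∃ e : Fin w.1 ≃ Fin w'.1, ∀ i, w.2 i = w'.2 (e i)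

theorem Symm.eq_of_same {E : Type*} {f : Word → E} (hf : Symm f) {w w' : Word}
    (h : w.Same w') : f w = f w' := by
  obtain ⟨n, v⟩ := w
  obtain ⟨m, v'⟩ := w'
  obtain ⟨e, he⟩ := h
  obtain rfl : n = m := by simpa using Fintype.card_congr e
  rw [← hf n v' e]
  congr 2
  funext i
  exact he i

/-- Symmetry of a function of eight words. -/
def SymmAll {E : Type*} (h : (Fin 8 → Word) → E) : Prop :=
  ∀ z z' : Fin 8 → Word, (∀ k, (z k).Same (z' k)) → h z = h z'

theorem SymmAll.comp {E F : Type*} {h : (Fin 8 → Word) → E} (hh : SymmAll h) (g : E → F) :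
    SymmAll fun z => g (h z) := fun z z' hz => congrArg g (hh z z' hz)

theorem Arrangement.words_same {n : Fin 8 → ℕ} {N : ℕ} (x : Arrangement n N) (y : Fin N → ℝ)
    (k : Fin 8) : (x.words y k).Same ((stdArr x.1).words y k) :=
  ⟨(x.2 k).trans ((stdArr x.1).2 k).symm, fun i => by
    refine congrArg (fun u : Meet x.1 k => y u.1) ?_
    exact (((stdArr x.1).2 k).apply_symm_apply _).symm⟩

theorem SymmAll.words_eq {E : Type*} {h : (Fin 8 → Word) → E} (hh : SymmAll h) {n : Fin 8 → ℕ}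
    {N : ℕ} (x : Arrangement n N) (y : Fin N → ℝ) :
    h (x.words y) = h (Conf.words ⟨⟨N, x.1⟩, y⟩) :=
  hh _ _ (x.words_same y)

theorem lintegral_conf (h : Conf → ENNReal) : ∫⁻ w, h w ∂conf =
    ∑' (N : ℕ) (c : Fin N → Fin 11), (N.factorial : ENNReal)⁻¹ * ∫⁻ y, h ⟨⟨N, c⟩, y⟩ := by
  rw [conf, lintegral_sum_measure, ENNReal.tsum_sigma']
  simp_rw [lintegral_smul_measure, (measurableEmbedding_sigma_mk _).lintegral_map, smul_eq_mul]

/-- The types force the length of each word, and each word can then be ordered in `(n k)!` ways,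
which cancels the weights. -/
theorem tsum_arrangements {N : ℕ} (c : Fin N → Fin 11) :
    ∑' (n : Fin 8 → ℕ) (_ : ∀ k, Fin (n k) ≃ Meet c k),
      (∏ k, ((n k).factorial : ENNReal))⁻¹ = 1 := by
  classical
  rw [tsum_eq_single (fun k => Fintype.card (Meet c k))]
  · rw [tsum_fintype, Finset.sum_const, Finset.card_univ, Fintype.card_pi, nsmul_eq_mul]
    have : ∀ k, Fintype.card (Fin (Fintype.card (Meet c k)) ≃ Meet c k) =
        (Fintype.card (Meet c k)).factorial := fun k => by
      rw [Fintype.card_equiv (Fintype.equivFin _).symm, Fintype.card_fin]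
    simp_rw [this]
    push_cast
    apply ENNReal.mul_inv_cancel
    · rw [Finset.prod_ne_zero_iff]
      exact fun k _ => by simp [Nat.factorial_ne_zero]
    · exact ENNReal.prod_ne_top fun k _ => by simp
  · intro n hn
    have : IsEmpty (∀ k, Fin (n k) ≃ Meet c k) :=
      ⟨fun b => hn (funext fun k => by simpa using Fintype.card_congr (b k))⟩
    simp

/-- Symmetry makes the integrand independent of the order chosen in each word, so only the types
matter and the sum over orders is absorbed by `tsum_arrangements`. Symmetry is essential: `𝔪` is not
the image of `conf` under `Conf.words`. -/
theorem SymmAll.lintegral_mMeasure {h : (Fin 8 → Word) → ENNReal} (hh : SymmAll h) :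
    ∫⁻ z, h z ∂mMeasure = ∫⁻ w, h (Conf.words w) ∂conf := by
  rw [mMeasure_eq, lintegral_sum_measure, lintegral_conf]
  have h1 : ∀ z : (Σ n : Fin 8 → ℕ, Σ N, Arrangement n N), ∫⁻ a, h a
      ∂(((∏ k, ((z.1 k).factorial : ENNReal))⁻¹ * (z.2.1.factorial : ENNReal)⁻¹) •
        Measure.map z.2.2.words volume) = (∏ k, ((z.1 k).factorial : ENNReal))⁻¹ *
          ((z.2.1.factorial : ENNReal)⁻¹ * ∫⁻ y, h (Conf.words ⟨⟨z.2.1, z.2.2.1⟩, y⟩)) := by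
    intro z
    rw [lintegral_smul_measure, z.2.2.measurableEmbedding_words.lintegral_map, smul_eq_mul,
      mul_assoc]
    simp_rw [hh.words_eq]
  rw [tsum_congr h1, ENNReal.tsum_sigma']
  refine (tsum_congr fun n => (ENNReal.tsum_sigma' _).trans
    (tsum_congr fun N => ENNReal.tsum_sigma' _)).trans ?_
  -- The sums are exchanged so that `N` and the types `c` are fixed outside, and word lengths and
  -- orders are summed inside.
  rw [ENNReal.tsum_comm]
  congr 1
  funext N
  rw [ENNReal.tsum_comm]
  congr 1
  funext c
  change ∑' (n : Fin 8 → ℕ) (_ : ∀ k, Fin (n k) ≃ Meet c k),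
      (∏ k, ((n k).factorial : ENNReal))⁻¹ *
        ((N.factorial : ENNReal)⁻¹ * ∫⁻ y, h (Conf.words ⟨⟨N, c⟩, y⟩)) = _
  simp_rw [ENNReal.tsum_mul_right]
  rw [tsum_arrangements, one_mul]

theorem aestronglyMeasurable_conf_iff {E : Type*} [TopologicalSpace E]
    [TopologicalSpace.PseudoMetrizableSpace E] {h : Conf → E} :
    AEStronglyMeasurable h conf ↔ ∀ (N : ℕ) (c : Fin N → Fin 11),
      AEStronglyMeasurable (fun y => h ⟨⟨N, c⟩, y⟩) volume := by
  rw [conf, aestronglyMeasurable_sum_measure_iff]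
  have h0 : ∀ N : ℕ, (N.factorial : ENNReal)⁻¹ ≠ 0 := fun N => by simp
  constructor
  · intro H N c
    have := (H ⟨N, c⟩).mono_ac (Measure.absolutelyContinuous_smul (h0 N))
    rw [(measurableEmbedding_sigma_mk _).aestronglyMeasurable_map_iff] at this
    exact this
  · rintro H ⟨N, c⟩
    apply AEStronglyMeasurable.smul_measure
    rw [(measurableEmbedding_sigma_mk _).aestronglyMeasurable_map_iff]
    exact H N c

theorem SymmAll.aestronglyMeasurable {E : Type*} [TopologicalSpace E]
    [TopologicalSpace.PseudoMetrizableSpace E] {h : (Fin 8 → Word) → E} (hh : SymmAll h)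
    (H : AEStronglyMeasurable (fun w => h (Conf.words w)) conf) :
    AEStronglyMeasurable h mMeasure := by
  rw [mMeasure_eq, aestronglyMeasurable_sum_measure_iff]
  intro z
  apply AEStronglyMeasurable.smul_measure
  rw [z.2.2.measurableEmbedding_words.aestronglyMeasurable_map_iff]
  have : h ∘ z.2.2.words = fun y => h (Conf.words ⟨⟨z.2.1, z.2.2.1⟩, y⟩) := by
    funext y
    exact hh.words_eq _ _
  rw [this]
  exact aestronglyMeasurable_conf_iff.1 H _ _

theorem SymmAll.integrable {E : Type*} [NormedAddCommGroup E] {h : (Fin 8 → Word) → E}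
    (hh : SymmAll h) (H : Integrable (fun w => h (Conf.words w)) conf) :
    Integrable h mMeasure := by
  refine ⟨hh.aestronglyMeasurable H.1, ?_⟩
  rw [HasFiniteIntegral, SymmAll.lintegral_mMeasure (hh.comp fun a => ‖a‖ₑ)]
  exact H.2

/-- Positive and negative parts inherit the symmetry, so the lower integrals already compared are
enough. -/
theorem SymmAll.integral_real {h : (Fin 8 → Word) → ℝ} (hh : SymmAll h)
    (H : Integrable (fun w => h (Conf.words w)) conf) :
    ∫ z, h z ∂mMeasure = ∫ w, h (Conf.words w) ∂conf := by
  rw [integral_eq_lintegral_pos_part_sub_lintegral_neg_part H,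
    integral_eq_lintegral_pos_part_sub_lintegral_neg_part (hh.integrable H),
    SymmAll.lintegral_mMeasure (hh.comp fun a => ENNReal.ofReal a),
    SymmAll.lintegral_mMeasure (hh.comp fun a => ENNReal.ofReal (-a))]

theorem SymmAll.integral_complex {h : (Fin 8 → Word) → ℂ} (hh : SymmAll h)
    (H : Integrable (fun w => h (Conf.words w)) conf) :
    ∫ z, h z ∂mMeasure = ∫ w, h (Conf.words w) ∂conf := by
  have h1 := SymmAll.integral_real (hh.comp Complex.re) H.re
  have h2 := SymmAll.integral_real (hh.comp Complex.im) H.im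
  have e1 := integral_re (hh.integrable H)
  have e2 := integral_im (hh.integrable H)
  have e3 := integral_re H
  have e4 := integral_im H
  exact Complex.ext (e1.symm.trans (h1.trans e3)) (e2.symm.trans (h2.trans e4))

/-! ### Adding a point to a configuration -/

/-- The multiset of the letters of a word. -/
def Word.letters (w : Word) : Multiset ℝ := ∑ i, {w.2 i}

theorem Word.count_letters (w : Word) (c : ℝ) :
    w.letters.count c = Fintype.card {i // w.2 i = c} := by
  rw [Word.letters, Multiset.count_sum', Fintype.card_subtype, Finset.card_filter]
  simp [Multiset.count_singleton, eq_comm]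

/-- Equal multiplicities give a bijection between the fibres over each real number, and these are
glued. Multisets make the effect of adding a letter a matter of addition. -/
theorem Word.same_of_letters {w w' : Word} (h : w.letters = w'.letters) : w.Same w' := by
  have hc : ∀ c, Nonempty ({i // w.2 i = c} ≃ {i // w'.2 i = c}) := fun c => by
    rw [← Fintype.card_eq, ← Word.count_letters, ← Word.count_letters, h]
  exact ⟨Equiv.ofFiberEquiv fun c => (hc c).some, fun i => (Equiv.ofFiberEquiv_map _ i).symm⟩

theorem Conf.letters_words (w : Conf) (k : Fin 8) :
    (w.words k).letters = ∑ u, if mem (w.1.2 u) k then {w.2 u} else 0 := by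
  rw [← Finset.sum_filter, Finset.sum_subtype (p := fun u => mem (w.1.2 u) k = true) _ (by simp)]
  exact (Fintype.equivFin (Meet w.1.2 k)).symm.sum_comp fun u => ({w.2 u.1} : Multiset ℝ)

/-- The configuration `w` with an additional point `t` of type `c` in the place `i`. -/
def Conf.insert (w : Conf) (i : Fin (w.1.1 + 1)) (c : Fin 11) (t : ℝ) : Conf :=
  ⟨⟨w.1.1 + 1, i.insertNth c w.1.2⟩, i.insertNth t w.2⟩

/-- Add the letter `t` to a word if the condition `b` holds. -/
def Word.addIf (b : Bool) (t : ℝ) (w : Word) : Word := if b then Word.add t w else w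

theorem Conf.words_insert (w : Conf) (i : Fin (w.1.1 + 1)) (c : Fin 11) (t : ℝ) (k : Fin 8) :
    ((w.insert i c t).words k).Same (Word.addIf (mem c k) t (w.words k)) := by
  apply Word.same_of_letters
  have h1 : ((w.insert i c t).words k).letters =
      (if mem c k then {t} else 0) + (w.words k).letters := by
    rw [Conf.letters_words, Conf.letters_words]
    refine (Fin.sum_univ_succAbove _ i).trans ?_
    simp [Conf.insert]
  rw [h1]
  cases mem c k
  · simp [Word.addIf]
  · simp [Word.addIf, Word.add, Word.letters]
    symm
    refine (Fin.sum_univ_succ fun i => ({Fin.cons (α := fun _ => ℝ) t (w.words k).2 i} : Multiset ℝ)).trans ?_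
    simp

/-! ### Integrals over configurations as sums -/

theorem hasSum_conf {E : Type*} [NormedAddCommGroup E] [NormedSpace ℝ E] {h : Conf → E}
    (H : Integrable h conf) :
    HasSum (fun a : Σ N : ℕ, Fin N → Fin 11 => (a.1.factorial : ℝ)⁻¹ • ∫ y, h ⟨a, y⟩)
      (∫ w, h w ∂conf) := by
  rw [conf] at H ⊢
  have := hasSum_integral_measure H
  convert this using 2 with a
  rw [integral_smul_measure, (measurableEmbedding_sigma_mk _).integral_map]
  simp

theorem prod_conf : (volume : Measure ℝ).prod conf = Measure.sum fun a : Σ N : ℕ, Fin N → Fin 11 =>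
    (a.1.factorial : ENNReal)⁻¹ • Measure.map (Prod.map id (Sigma.mk a))
      ((volume : Measure ℝ).prod (volume : Measure (Fin a.1 → ℝ))) := by
  have : ∀ a : Σ N : ℕ, Fin N → Fin 11, SFinite ((a.1.factorial : ENNReal)⁻¹ •
    Measure.map (fun y : Fin a.1 → ℝ => (⟨a, y⟩ : Conf)) volume) := fun a => inferInstance
  rw [conf, Measure.prod_sum_right]
  congr 1
  funext a
  have h := Measure.map_prod_map (volume : Measure ℝ) (volume : Measure (Fin a.1 → ℝ)) measurable_id
    (measurable_sigma_mk (β := fun a : Σ N : ℕ, Fin N → Fin 11 => Fin a.1 → ℝ) a)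
  rw [Measure.map_id] at h
  rw [Measure.prod_smul_right, h]

theorem measurableEmbedding_prod_mk (a : Σ N : ℕ, Fin N → Fin 11) :
    MeasurableEmbedding (Prod.map id (fun y => ⟨a, y⟩) : ℝ × (Fin a.1 → ℝ) → ℝ × Conf) :=
  MeasurableEmbedding.id.prodMap (measurableEmbedding_sigma_mk
    (β := fun a : Σ N : ℕ, Fin N → Fin 11 => Fin a.1 → ℝ) a)

theorem aestronglyMeasurable_prod_conf {E : Type*} [TopologicalSpace E]
    [TopologicalSpace.PseudoMetrizableSpace E] {h : ℝ × Conf → E}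
    (H : ∀ (N : ℕ) (c : Fin N → Fin 11), AEStronglyMeasurable
      (fun p : ℝ × (Fin N → ℝ) => h (p.1, ⟨⟨N, c⟩, p.2⟩)) (volume.prod volume)) :
    AEStronglyMeasurable h (volume.prod conf) := by
  rw [prod_conf, aestronglyMeasurable_sum_measure_iff]
  rintro ⟨N, c⟩
  apply AEStronglyMeasurable.smul_measure
  rw [(measurableEmbedding_prod_mk _).aestronglyMeasurable_map_iff]
  exact H N c

theorem integrable_of_prod_conf {E : Type*} [NormedAddCommGroup E] {h : ℝ × Conf → E}
    (H : Integrable h (volume.prod conf)) (a : Σ N : ℕ, Fin N → Fin 11) :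
    Integrable (fun p : ℝ × (Fin a.1 → ℝ) => h (p.1, ⟨a, p.2⟩)) (volume.prod volume) := by
  rw [prod_conf] at H
  have := H.mono_measure (Measure.le_sum _ a)
  rw [integrable_smul_measure (by simp) (by simp [Nat.factorial_ne_zero]),
    (measurableEmbedding_prod_mk a).integrable_map_iff] at this
  exact this

theorem hasSum_prod_conf {E : Type*} [NormedAddCommGroup E] [NormedSpace ℝ E] {h : ℝ × Conf → E}
    (H : Integrable h (volume.prod conf)) :
    HasSum (fun a : Σ N : ℕ, Fin N → Fin 11 =>
      (a.1.factorial : ℝ)⁻¹ • ∫ p : ℝ × (Fin a.1 → ℝ), h (p.1, ⟨a, p.2⟩) ∂volume.prod volume)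
      (∫ p, h p ∂volume.prod conf) := by
  rw [prod_conf] at H ⊢
  have := hasSum_integral_measure H
  convert this using 2 with a
  rw [integral_smul_measure, (measurableEmbedding_prod_mk _).integral_map]
  simp [Prod.map]

/-! ### The sum over the points of a configuration -/

/-- The sum of a function over the points of a configuration; the function depends on the type
of the point, the point, and the other points. -/
def pointSum (k : Fin 11 → ℝ → Conf → ℂ) : Conf → ℂ
  | ⟨⟨0, _⟩, _⟩ => 0
  | ⟨⟨N + 1, c⟩, y⟩ => ∑ i : Fin (N + 1),
      k (c i) (y i) ⟨⟨N, fun j => c (i.succAbove j)⟩, fun j => y (i.succAbove j)⟩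

theorem integral_point {N : ℕ} (i : Fin (N + 1)) (h : ℝ → (Fin N → ℝ) → ℂ) :
    ∫ y : Fin (N + 1) → ℝ, h (y i) (fun j => y (i.succAbove j)) =
      ∫ p : ℝ × (Fin N → ℝ), h p.1 p.2 ∂volume.prod volume :=
  (volume_preserving_piFinSuccAbove (fun _ : Fin (N + 1) => ℝ) i).integral_comp'
    fun p : ℝ × (Fin N → ℝ) => h p.1 p.2

theorem integrable_point {N : ℕ} (i : Fin (N + 1)) {h : ℝ → (Fin N → ℝ) → ℂ}
    (H : Integrable (fun p : ℝ × (Fin N → ℝ) => h p.1 p.2) (volume.prod volume)) :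
    Integrable fun y : Fin (N + 1) → ℝ => h (y i) (fun j => y (i.succAbove j)) :=
  (volume_preserving_piFinSuccAbove (fun _ : Fin (N + 1) => ℝ) i).integrable_comp_of_integrable H

theorem sum_types {N : ℕ} (i : Fin (N + 1)) (d : Fin 11 → (Fin N → Fin 11) → ℂ) :
    ∑ c : Fin (N + 1) → Fin 11, d (c i) (fun j => c (i.succAbove j)) = ∑ b, ∑ c, d b c := by
  rw [← Fintype.sum_prod_type', ← (Fin.insertNthEquiv (fun _ => Fin 11) i).sum_comp]
  simp

/-- A Mecke formula: singling out one of `N + 1` points leaves a configuration of `N` points, and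
the `N + 1` equal choices turn the weight `1/(N+1)!` into `1/N!`. -/
theorem integral_pointSum {k : Fin 11 → ℝ → Conf → ℂ}
    (hk : ∀ b, Integrable (fun p : ℝ × Conf => k b p.1 p.2) (volume.prod conf))
    (hs : Integrable (pointSum k) conf) :
    ∫ w, pointSum k w ∂conf = ∑ b, ∫ p, k b p.1 p.2 ∂volume.prod conf := by
  let d : ∀ N : ℕ, Fin 11 → (Fin N → Fin 11) → ℂ := fun N b c =>
    ∫ p : ℝ × (Fin N → ℝ), k b p.1 ⟨⟨N, c⟩, p.2⟩ ∂volume.prod volume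
  have h1 := (hasSum_conf hs).sigma fun N => hasSum_fintype _
  have h2 := hasSum_sum (s := Finset.univ) fun b _ =>
    (hasSum_prod_conf (hk b)).sigma fun N => hasSum_fintype _
  have h3 : ∀ N : ℕ, ∑ c : Fin (N + 1) → Fin 11, ((N + 1).factorial : ℝ)⁻¹ •
      ∫ y, pointSum k ⟨⟨N + 1, c⟩, y⟩ = ∑ b, ∑ c : Fin N → Fin 11, (N.factorial : ℝ)⁻¹ • d N b c := by
    intro N
    have e1 : ∀ c : Fin (N + 1) → Fin 11, ∫ y, pointSum k ⟨⟨N + 1, c⟩, y⟩ =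
        ∑ i, d N (c i) (fun j => c (i.succAbove j)) := by
      intro c
      simp only [pointSum]
      rw [integral_finsetSum]
      · exact Finset.sum_congr rfl fun i _ => integral_point i
          fun t y => k (c i) t ⟨⟨N, fun j => c (i.succAbove j)⟩, y⟩
      · exact fun i _ => integrable_point i
          (h := fun t y => k (c i) t ⟨⟨N, fun j => c (i.succAbove j)⟩, y⟩) (integrable_of_prod_conf (hk (c i)) ⟨N, _⟩)
    simp_rw [e1, ← Finset.smul_sum]
    rw [Finset.sum_comm]
    simp_rw [sum_types]
    rw [Finset.sum_const, Finset.card_univ, Fintype.card_fin, ← Nat.cast_smul_eq_nsmul ℝ, smul_smul,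
      Nat.factorial_succ]
    congr 1
    have : (N.factorial : ℝ) ≠ 0 := by exact_mod_cast Nat.factorial_ne_zero N
    push_cast
    field_simp
  -- The index is shifted by one: the empty configuration has no point to single out and contributes
  -- zero.
  have h4 := (hasSum_nat_add_iff' 1).2 h1
  simp only [Finset.range_one, Finset.sum_singleton] at h4
  have h5 : ∑ c : Fin 0 → Fin 11, ((Nat.factorial 0 : ℕ) : ℝ)⁻¹ •
      ∫ y, pointSum k ⟨⟨0, c⟩, y⟩ = 0 := by simp [pointSum]
  rw [h5, sub_zero] at h4
  simp_rw [h3] at h4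
  exact h4.unique h2

/-! ### The fundamental theorem of calculus for functions with jumps -/

theorem eventually_notMem_finset (P : Finset ℝ) (t : ℝ) : ∀ᶠ u in 𝓝[≠] t, u ∉ P := by
  have h : IsClosed ((P : Set ℝ) \ {t}) := (P.finite_toSet.subset Set.sdiff_subset).isClosed
  have h1 : ∀ᶠ u in 𝓝 t, u ∉ (P : Set ℝ) \ {t} := h.isOpen_compl.mem_nhds (by simp)
  filter_upwards [nhdsWithin_le_nhds h1, self_mem_nhdsWithin] with u hu hut hP
  exact hu ⟨hP, hut⟩

theorem eventually_lt_iff_left (p t : ℝ) : ∀ᶠ u in 𝓝[<] t, (p < u ↔ p < t) := by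
  by_cases h : p < t
  · filter_upwards [nhdsWithin_le_nhds (Ioi_mem_nhds h)] with u hu
    exact ⟨fun _ => h, fun _ => hu⟩
  · filter_upwards [self_mem_nhdsWithin] with u hu
    have hu : u < t := hu
    exact ⟨fun h' => h'.trans hu, fun h' => absurd h' h⟩

theorem eventually_lt_iff_right (p t : ℝ) : ∀ᶠ u in 𝓝[>] t, (p < u ↔ p ≤ t) := by
  by_cases h : p ≤ t
  · filter_upwards [self_mem_nhdsWithin] with u hu
    have hu : t < u := hu
    exact ⟨fun _ => h, fun _ => h.trans_lt hu⟩
  · filter_upwards [nhdsWithin_le_nhds (Iio_mem_nhds (not_le.1 h))] with u hu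
    have hu : u < p := hu
    exact ⟨fun h' => absurd h' hu.not_gt, fun h' => absurd h' h⟩

section Jumps

variable (P : Finset ℝ) (G L R : ℝ → ℂ)

/-- The function `G` with its jumps at the points of `P` removed. -/
def removeJumps (t : ℝ) : ℂ :=
  (if t ∈ P then L t else G t) - ∑ p ∈ P, if p < t then R p - L p else 0

variable {P G L R}

/-- At a jump the corrected function takes the left limit, and the strict inequality `p < t` leaves
the jump at `t` itself out of the sum, which gives left continuity. On the right the subtracted jump
`R t - L t` compensates exactly. -/
theorem continuous_removeJumps (hc : ∀ t ∉ P, ContinuousAt G t)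
    (hL : ∀ p ∈ P, Tendsto G (𝓝[<] p) (𝓝 (L p))) (hR : ∀ p ∈ P, Tendsto G (𝓝[>] p) (𝓝 (R p))) :
    Continuous (removeJumps P G L R) := by
  rw [continuous_iff_continuousAt]
  intro t
  rw [continuousAt_iff_continuous_left'_right']
  constructor
  · refine Tendsto.sub ?_ (tendsto_finsetSum _ fun p _ => ?_)
    · have h : G =ᶠ[𝓝[<] t] fun t => if t ∈ P then L t else G t := by
        filter_upwards [nhdsWithin_mono t (fun u (hu : u < t) => hu.ne)
          (eventually_notMem_finset P t)] with u hu
        simp [hu]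
      refine Tendsto.congr' h ?_
      split_ifs with ht
      · exact hL t ht
      · exact (hc t ht).mono_left nhdsWithin_le_nhds
    · refine tendsto_const_nhds.congr' ?_
      filter_upwards [eventually_lt_iff_left p t] with u hu
      simp only [hu]
  -- The same value written with right limits and `p ≤ t`, the form in which the limit from the
  -- right appears.
  · have key : removeJumps P G L R t =
        (if t ∈ P then R t else G t) - ∑ p ∈ P, if p ≤ t then R p - L p else 0 := by
      have h1 : ∀ p ∈ P, (if p ≤ t then R p - L p else 0) =
          (if p < t then R p - L p else 0) + if t = p then R p - L p else 0 := by
        intro p _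
        rcases lt_trichotomy p t with h | h | h
        · simp [h, h.le, h.ne']
        · simp [h]
        · simp [h.not_gt, h.not_ge, h.ne]
      rw [removeJumps, Finset.sum_congr rfl h1, Finset.sum_add_distrib, Finset.sum_ite_eq]
      split_ifs <;> ring
    rw [ContinuousWithinAt, key]
    refine Tendsto.sub ?_ (tendsto_finsetSum _ fun p _ => ?_)
    · have h : G =ᶠ[𝓝[>] t] fun t => if t ∈ P then L t else G t := by
        filter_upwards [nhdsWithin_mono t (fun u (hu : t < u) => hu.ne')
          (eventually_notMem_finset P t)] with u hu
        simp [hu]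
      refine Tendsto.congr' h ?_
      split_ifs with ht
      · exact hR t ht
      · exact (hc t ht).mono_left nhdsWithin_le_nhds
    · refine tendsto_const_nhds.congr' ?_
      filter_upwards [eventually_lt_iff_right p t] with u hu
      simp only [hu]

theorem hasDerivAt_removeJumps {t : ℝ} (ht : t ∉ P) {g : ℂ} (h : HasDerivAt G g t) :
    HasDerivAt (removeJumps P G L R) g t := by
  have h1 : ∀ᶠ u in 𝓝 t, u ∉ P := P.finite_toSet.isClosed.isOpen_compl.mem_nhds ht
  have h2 : ∀ᶠ u in 𝓝 t, ∀ p ∈ P, (p < u ↔ p < t) := by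
    rw [Filter.eventually_all_finset]
    intro p hp
    rcases lt_or_gt_of_ne (fun h : p = t => ht (h ▸ hp)) with h | h
    · filter_upwards [Ioi_mem_nhds h] with u hu
      exact ⟨fun _ => h, fun _ => hu⟩
    · filter_upwards [Iio_mem_nhds h] with u hu
      exact ⟨fun h' => absurd h' (lt_asymm hu), fun h' => absurd h' (lt_asymm h)⟩
  refine (h.sub_const (∑ p ∈ P, if p < t then R p - L p else 0)).congr_of_eventuallyEq ?_
  filter_upwards [h1, h2] with u hu hu'
  rw [removeJumps, if_neg hu]
  congr 1
  exact Finset.sum_congr rfl fun p hp => by simp only [hu' p hp]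

/-- The function without its jumps is continuous and has derivative `g` off a finite set, so the
fundamental theorem applies on an interval containing the support and all of `P`. At the left end
the corrected function is zero; at the right end only the accumulated jumps remain. -/
theorem integral_deriv_of_jumps {g : ℝ → ℂ} (hG : HasCompactSupport G)
    (hd : ∀ t ∉ P, HasDerivAt G (g t) t)
    (hL : ∀ p ∈ P, Tendsto G (𝓝[<] p) (𝓝 (L p))) (hR : ∀ p ∈ P, Tendsto G (𝓝[>] p) (𝓝 (R p)))
    (hg : Integrable g) : ∫ t, g t = -∑ p ∈ P, (R p - L p) := by
  obtain ⟨M, hM⟩ := (hG.isCompact.isBounded.union P.finite_toSet.isBounded).subset_ball 0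
  have hGM : ∀ t, M ≤ |t| → t ∉ tsupport G := fun t ht h => by
    have := hM (Or.inl h)
    rw [mem_ball_zero_iff, Real.norm_eq_abs] at this
    linarith
  have hPM : ∀ t ∈ P, |t| < M := fun t ht => by
    have := hM (Or.inr ht)
    rwa [mem_ball_zero_iff, Real.norm_eq_abs] at this
  have hg0 : ∀ t, M ≤ |t| → g t = 0 := by
    intro t ht
    have h0 : G =ᶠ[𝓝 t] fun _ => 0 := notMem_tsupport_iff_eventuallyEq.1 (hGM t ht)
    have h1 := hd t fun h => absurd (hPM t h) (not_lt.2 ht)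
    exact h1.unique ((hasDerivAt_const t (0 : ℂ)).congr_of_eventuallyEq h0)
  -- A negative radius can only occur when there is nothing to integrate and no jump.
  wlog hM0 : 0 ≤ M generalizing M
  · have h1 : ∀ t, M ≤ |t| := fun t => (not_le.1 hM0).le.trans (abs_nonneg t)
    have h2 : P = ∅ := by
      rw [Finset.eq_empty_iff_forall_notMem]
      intro t ht
      exact absurd (hPM t ht) (not_lt.2 (h1 t))
    simp [fun t => hg0 t (h1 t), h2]
  have hsupp : Function.support g ⊆ Set.Ioc (-M) M := by
    intro t ht
    by_contra h
    apply ht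
    apply hg0
    rw [Set.mem_Ioc, not_and_or, not_lt, not_le] at h
    rcases h with h | h
    · exact le_abs.2 (Or.inr (by linarith))
    · exact le_abs.2 (Or.inl h.le)
  rw [← intervalIntegral.integral_eq_integral_of_support_subset hsupp,
    integral_eq_of_hasDerivAt_off_countable (removeJumps P G L R) g P.countable_toSet
      (continuous_removeJumps (fun t ht => (hd t ht).continuousAt) hL hR).continuousOn
      (fun t ht => hasDerivAt_removeJumps ht.2 (hd t ht.2)) hg.intervalIntegrable]
  have hM1 : removeJumps P G L R M = -∑ p ∈ P, (R p - L p) := by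
    have h1 : M ∉ P := fun h => absurd (hPM M h) (by rw [abs_of_nonneg hM0]; exact lt_irrefl M)
    have h2 : G M = 0 := image_eq_zero_of_notMem_tsupport (hGM M (le_abs_self M))
    rw [removeJumps, if_neg h1, h2, zero_sub]
    congr 1
    exact Finset.sum_congr rfl fun p hp => if_pos ((le_abs_self p).trans_lt (hPM p hp))
  have hM2 : removeJumps P G L R (-M) = 0 := by
    have h1 : -M ∉ P := fun h => absurd (hPM _ h)
      (by rw [abs_neg, abs_of_nonneg hM0]; exact lt_irrefl M)
    have h2 : G (-M) = 0 := image_eq_zero_of_notMem_tsupport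
      (hGM _ (by rw [abs_neg]; exact le_abs_self M))
    rw [removeJumps, if_neg h1, h2, zero_sub, neg_eq_zero]
    refine Finset.sum_eq_zero fun p hp => if_neg fun h => ?_
    have := abs_lt.1 (hPM p hp)
    linarith
  rw [hM1, hM2, sub_zero]

end Jumps

/-! ### Configurations of different points -/

/-- All points of the configuration are different, and different from `t`. -/
def Apart (t : ℝ) (w : Conf) : Prop := Function.Injective w.2 ∧ ∀ u, w.2 u ≠ t

/-- Three index sets such that a chain meets at most one of them. -/
def Separate (a b d : Fin 8) : Prop :=
  ∀ c, ¬(mem c a ∧ mem c b) ∧ ¬(mem c a ∧ mem c d) ∧ ¬(mem c b ∧ mem c d)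

theorem separate_one : Separate 1 2 3 := by unfold Separate; decide

theorem separate_two : Separate 4 5 6 := by unfold Separate; decide

theorem Conf.words_apply (w : Conf) (k : Fin 8) (i : Fin (w.words k).1) :
    (w.words k).2 i = w.2 ((stdArr w.1.2).label ⟨k, i⟩) := rfl

theorem Conf.injective_words {w : Conf} (h : Function.Injective w.2) (k : Fin 8) :
    Function.Injective (w.words k).2 := by
  intro i j hij
  rw [w.words_apply, w.words_apply] at hij
  exact ((stdArr w.1.2).2 k).injective (Subtype.ext (h hij))

theorem Conf.words_ne {w : Conf} (h : Function.Injective w.2) {k l : Fin 8}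
    (hkl : ∀ c, ¬(mem c k ∧ mem c l)) (i : Fin (w.words k).1) (j : Fin (w.words l).1) :
    (w.words k).2 i ≠ (w.words l).2 j := by
  intro hij
  rw [w.words_apply, w.words_apply] at hij
  have := h hij
  have h1 := (stdArr w.1.2).mem_label ⟨k, i⟩
  have h2 := (stdArr w.1.2).mem_label ⟨l, j⟩
  rw [← this] at h2
  exact hkl _ ⟨h1, h2⟩

/-- The three arguments of one operator lie in the same block, so no chain supplies a letter to two
of them. Hence coincidences of letters forced by a pairing never occur inside one operator, and the
regularity of class `C⁰` or `C¹` can be used. -/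
theorem Apart.distinct {t : ℝ} {w : Conf} (h : Apart t w) {a b d : Fin 8} (hs : Separate a b d) :
    (t, w.words a, w.words b, w.words d) ∈ Distinct := by
  have hn : ∀ k, (List.ofFn (w.words k).2).Nodup := fun k =>
    List.nodup_ofFn.2 (Conf.injective_words h.1 k)
  have ht : ∀ k, t ∉ List.ofFn (w.words k).2 := fun k hk => by
    obtain ⟨i, hi⟩ := (List.mem_ofFn' _ _).1 hk
    exact h.2 _ hi
  have hd : ∀ {k l}, (∀ c, ¬(mem c k ∧ mem c l)) →
      (List.ofFn (w.words k).2).Disjoint (List.ofFn (w.words l).2) := fun hkl x hx hy => by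
    obtain ⟨i, hi⟩ := (List.mem_ofFn' _ _).1 hx
    obtain ⟨j, hj⟩ := (List.mem_ofFn' _ _).1 hy
    exact Conf.words_ne h.1 hkl i j (hi.trans hj.symm)
  change (t :: (List.ofFn (w.words a).2 ++ List.ofFn (w.words b).2 ++
    List.ofFn (w.words d).2)).Nodup
  rw [List.nodup_cons]
  refine ⟨?_, ((hn a).append (hn b) (hd fun c => (hs c).1)).append (hn d) ?_⟩
  · simp only [List.mem_append, not_or]
    exact ⟨⟨ht a, ht b⟩, ht d⟩
  · rw [List.disjoint_append_left]
    exact ⟨hd fun c => (hs c).2.1, hd fun c => (hs c).2.2⟩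

theorem isOpen_apart (a : Σ N : ℕ, Fin N → Fin 11) :
    IsOpen {p : ℝ × (Fin a.1 → ℝ) | Apart p.1 ⟨a, p.2⟩} := by
  have : {p : ℝ × (Fin a.1 → ℝ) | Apart p.1 ⟨a, p.2⟩} =
      (⋂ u : Fin a.1, ⋂ v : Fin a.1, {p | u = v ∨ p.2 u ≠ p.2 v}) ∩
        ⋂ u : Fin a.1, {p | p.2 u ≠ p.1} := by
    ext p
    simp only [Apart, Function.Injective, Set.mem_inter_iff, Set.mem_iInter]
    refine and_congr (forall_congr' fun u => forall_congr' fun v => ?_) Iff.rfl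
    change _ ↔ (u = v ∨ p.2 u ≠ p.2 v)
    tauto
  rw [this]
  refine (isOpen_iInter_of_finite fun u => isOpen_iInter_of_finite fun v => ?_).inter
    (isOpen_iInter_of_finite fun u => ?_)
  · by_cases h : u = v
    · simp [h]
    · simp only [h, false_or]
      exact isOpen_ne_fun (by fun_prop) (by fun_prop)
  · exact isOpen_ne_fun (by fun_prop) (by fun_prop)

theorem ae_ne_of_linear {E : Type*} [NormedAddCommGroup E] [NormedSpace ℝ E] [MeasurableSpace E]
    [BorelSpace E] [FiniteDimensional ℝ E] (μ : Measure E) [μ.IsAddHaarMeasure]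
    (l m : E →ₗ[ℝ] ℝ) (h : l ≠ m) : ∀ᵐ x ∂μ, l x ≠ m x := by
  have h1 : LinearMap.ker (l - m) ≠ ⊤ := fun h' => h (sub_eq_zero.1 (LinearMap.ker_eq_top.1 h'))
  have h2 := Measure.addHaar_submodule μ _ h1
  rw [ae_iff]
  convert h2 using 2
  ext x
  simp [sub_eq_zero]

theorem ae_apart_aux (a : Σ N : ℕ, Fin N → Fin 11) :
    ∀ᵐ p : ℝ × (Fin a.1 → ℝ) ∂volume.prod volume, Apart p.1 ⟨a, p.2⟩ := by
  have h1 : ∀ᵐ p : ℝ × (Fin a.1 → ℝ) ∂volume.prod volume, ∀ u v, u ≠ v → p.2 u ≠ p.2 v := by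
    rw [ae_all_iff]
    intro u
    rw [ae_all_iff]
    intro v
    by_cases h : u = v
    · simp [h]
    · have := ae_ne_of_linear ((volume : Measure ℝ).prod (volume : Measure (Fin a.1 → ℝ)))
        ((LinearMap.proj u).comp (LinearMap.snd ℝ ℝ (Fin a.1 → ℝ)))
        ((LinearMap.proj v).comp (LinearMap.snd ℝ ℝ (Fin a.1 → ℝ))) fun h' => by
          have := LinearMap.congr_fun h' (0, Pi.single u 1)
          simp [Ne.symm h] at this
      filter_upwards [this] with p hp _ using hp
  have h2 : ∀ᵐ p : ℝ × (Fin a.1 → ℝ) ∂volume.prod volume, ∀ u, p.2 u ≠ p.1 := by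
    rw [ae_all_iff]
    intro u
    exact ae_ne_of_linear ((volume : Measure ℝ).prod (volume : Measure (Fin a.1 → ℝ)))
      ((LinearMap.proj u).comp (LinearMap.snd ℝ ℝ (Fin a.1 → ℝ)))
      (LinearMap.fst ℝ ℝ (Fin a.1 → ℝ)) fun h' => by
        have := LinearMap.congr_fun h' (1, 0)
        simp at this
  filter_upwards [h1, h2] with p hp1 hp2
  exact ⟨fun u v huv => by_contra fun h => hp1 u v h huv, hp2⟩

theorem ae_apart : ∀ᵐ p : ℝ × Conf ∂volume.prod conf, Apart p.1 p.2 := by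
  rw [prod_conf, Measure.ae_sum_iff]
  intro a
  refine Measure.ae_smul_measure ?_ _
  rw [(measurableEmbedding_prod_mk a).ae_map_iff]
  exact ae_apart_aux a

/-! ### Measurability -/

/-- A function of a number and a word that is symmetric in the word and continuous. -/
structure IsFamily {K : Type*} [NormedAddCommGroup K] (f : ℝ → Word → K) : Prop where
  symm : ∀ t, Symm (f t)
  cont : ∀ n, Continuous fun p : ℝ × (Fin n → ℝ) => f p.1 ⟨n, p.2⟩

theorem IsTest.isFamily {K : Type*} [NormedAddCommGroup K] {f : Word → K} (hf : IsTest f) :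
    IsFamily fun _ => f where
  symm _ := hf.symm
  cont _ := (hf.cont.comp continuous_sigmaMk).comp continuous_snd

theorem Symm.annih {K : Type*} {f : Word → K} (hf : Symm f) (t : ℝ) : Symm (annih t f) := by
  intro n w p
  apply hf.eq_of_same
  apply Word.same_of_letters
  have key : ∀ v : Fin n → ℝ, (Word.add t ⟨n, v⟩).letters = {t} + ∑ i, {v i} := fun v =>
    (Fin.sum_univ_succ fun i => ({Fin.cons (α := fun _ => ℝ) t v i} : Multiset ℝ)).trans (by simp)
  rw [key, key]
  congr 1
  exact Equiv.sum_comp p fun i => ({w i} : Multiset ℝ)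

theorem IsTest.isFamily_annih {K : Type*} [NormedAddCommGroup K] {f : Word → K} (hf : IsTest f) :
    IsFamily fun t => annih t f where
  symm t := hf.symm.annih t
  cont n := by
    have h1 : Continuous fun w : Fin (n + 1) → ℝ => f ⟨n + 1, w⟩ := hf.cont.comp continuous_sigmaMk
    have h2 : Continuous fun p : ℝ × (Fin n → ℝ) => (Fin.cons p.1 p.2 : Fin (n + 1) → ℝ) :=
      continuous_pi fun i => by
        refine Fin.cases ?_ (fun j => ?_) i
        · simpa using continuous_fst
        · exact (continuous_apply j).comp continuous_snd
    exact h1.comp h2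

theorem continuous_letters (a : Σ N : ℕ, Fin N → Fin 11) (k : Fin 8) :
    Continuous fun (y : Fin a.1 → ℝ) (i : Fin (Fintype.card (Meet a.2 k))) =>
      y ((stdArr a.2).label ⟨k, i⟩) :=
  continuous_pi fun _ => continuous_apply _

theorem continuous_words (a : Σ N : ℕ, Fin N → Fin 11) (k : Fin 8) :
    Continuous fun y : Fin a.1 → ℝ => Conf.words ⟨a, y⟩ k := by
  have h : Continuous (Sigma.mk (Fintype.card (Meet a.2 k)) : _ → Word) := continuous_sigmaMk
  exact h.comp (continuous_letters a k)

theorem IsFamily.aestronglyMeasurable {K : Type*} [NormedAddCommGroup K] {f : ℝ → Word → K}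
    (hf : IsFamily f) (k : Fin 8) :
    AEStronglyMeasurable (fun p : ℝ × Conf => f p.1 (p.2.words k)) (volume.prod conf) := by
  refine aestronglyMeasurable_prod_conf fun N c => Continuous.aestronglyMeasurable ?_
  exact (hf.cont (Fintype.card (Meet c k))).comp
    (continuous_fst.prodMk ((continuous_letters ⟨N, c⟩ k).comp continuous_snd))

theorem IsC0.continuousOn_words {A : Type*} [NormedAddCommGroup A]
    {F : ℝ → Word → Word → Word → A} (hF : IsC0 F) {k l m : Fin 8} (hs : Separate k l m)
    (a : Σ N : ℕ, Fin N → Fin 11) : ContinuousOn (fun p : ℝ × (Fin a.1 → ℝ) =>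
      F p.1 (Conf.words ⟨a, p.2⟩ k) (Conf.words ⟨a, p.2⟩ l) (Conf.words ⟨a, p.2⟩ m))
      {p | Apart p.1 ⟨a, p.2⟩} := by
  have h1 : ∀ j, Continuous fun p : ℝ × (Fin a.1 → ℝ) => Conf.words ⟨a, p.2⟩ j :=
    fun j => (continuous_words a j).comp continuous_snd
  exact hF.cont.comp (continuous_fst.prodMk ((h1 k).prodMk ((h1 l).prodMk (h1 m)))).continuousOn
    fun p hp => Apart.distinct hp hs

/-- The function is continuous on the open set of pairwise different points, and its complement is
null, being a finite union of proper subspaces for each number of points. -/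
theorem IsC0.aestronglyMeasurable {A : Type*} [NormedAddCommGroup A]
    {F : ℝ → Word → Word → Word → A} (hF : IsC0 F) {k l m : Fin 8} (hs : Separate k l m) :
    AEStronglyMeasurable (fun p : ℝ × Conf =>
      F p.1 (p.2.words k) (p.2.words l) (p.2.words m)) (volume.prod conf) := by
  refine aestronglyMeasurable_prod_conf fun N c => ?_
  have h1 := (hF.continuousOn_words hs ⟨N, c⟩).aestronglyMeasurable
    (μ := (volume : Measure ℝ).prod volume) (isOpen_apart ⟨N, c⟩).measurableSet
  rwa [Measure.restrict_eq_self_of_ae_mem] at h1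
  exact ae_apart_aux ⟨N, c⟩

/-! ### The forms as integrals over configurations -/

section Forms

variable {K : Type*} [NormedAddCommGroup K] [InnerProductSpace ℂ K]

/-- The integrand of the form `⟨f|ℬ(F,G)|g⟩`. -/
def integrand (f : Word → K) (F G : Word → Word → Word → K →L[ℂ] K) (g : Word → K)
    (z : Fin 8 → Word) : ℂ :=
  inner ℂ (f (z 0)) (F (z 1) (z 2) (z 3) (G (z 4) (z 5) (z 6) (g (z 7))))

/-- The integrand of the integral of the norm. -/
def normIntegrand (f : Word → K) (F G : Word → Word → Word → K →L[ℂ] K) (g : Word → K)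
    (z : Fin 8 → Word) : ENNReal :=
  ‖f (z 0)‖ₑ * ‖F (z 1) (z 2) (z 3) ∘L G (z 4) (z 5) (z 6)‖ₑ * ‖g (z 7)‖ₑ

theorem enorm_integrand_le (f : Word → K) (F G : Word → Word → Word → K →L[ℂ] K) (g : Word → K)
    (z : Fin 8 → Word) : ‖integrand f F G g z‖ₑ ≤ normIntegrand f F G g z := by
  have h : ‖integrand f F G g z‖ ≤
      ‖f (z 0)‖ * ‖F (z 1) (z 2) (z 3) ∘L G (z 4) (z 5) (z 6)‖ * ‖g (z 7)‖ := by
    refine (norm_inner_le_norm _ _).trans ?_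
    rw [mul_assoc]
    exact mul_le_mul_of_nonneg_left
      ((F (z 1) (z 2) (z 3) ∘L G (z 4) (z 5) (z 6)).le_opNorm (g (z 7))) (norm_nonneg _)
  have h2 := enorm_le_iff_norm_le.2 (h.trans_eq (Real.norm_of_nonneg (by positivity)).symm)
  rwa [enorm_mul, enorm_mul, enorm_norm, enorm_norm, enorm_norm] at h2

/-- Symmetry in each of three words. -/
structure Symm₃ {A : Type*} (F : Word → Word → Word → A) : Prop where
  symm₁ : ∀ τ υ, Symm fun σ => F σ τ υ
  symm₂ : ∀ σ υ, Symm fun τ => F σ τ υ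
  symm₃ : ∀ σ τ, Symm fun υ => F σ τ υ

theorem Symm₃.eq_of_same {A : Type*} {F : Word → Word → Word → A} (hF : Symm₃ F)
    {σ σ' τ τ' υ υ' : Word} (h1 : σ.Same σ') (h2 : τ.Same τ') (h3 : υ.Same υ') :
    F σ τ υ = F σ' τ' υ' :=
  ((hF.symm₁ τ υ).eq_of_same h1).trans
    (((hF.symm₂ σ' υ).eq_of_same h2).trans ((hF.symm₃ σ' τ').eq_of_same h3))

theorem IsC0.symm₃_apply {A : Type*} [NormedAddCommGroup A] {F : ℝ → Word → Word → Word → A}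
    (hF : IsC0 F) (t : ℝ) : Symm₃ (F t) :=
  ⟨hF.symm₁ t, hF.symm₂ t, hF.symm₃ t⟩

variable {f g : Word → K} {F G : Word → Word → Word → K →L[ℂ] K}

theorem symmAll_integrand (hf : Symm f) (hF : Symm₃ F) (hG : Symm₃ G) (hg : Symm g) :
    SymmAll (integrand f F G g) := by
  intro z z' h
  rw [integrand, integrand, hf.eq_of_same (h 0), hF.eq_of_same (h 1) (h 2) (h 3),
    hG.eq_of_same (h 4) (h 5) (h 6), hg.eq_of_same (h 7)]

theorem symmAll_normIntegrand (hf : Symm f) (hF : Symm₃ F) (hG : Symm₃ G) (hg : Symm g) :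
    SymmAll (normIntegrand f F G g) := by
  intro z z' h
  rw [normIntegrand, normIntegrand, hf.eq_of_same (h 0), hF.eq_of_same (h 1) (h 2) (h 3),
    hG.eq_of_same (h 4) (h 5) (h 6), hg.eq_of_same (h 7)]

end Forms

section Families

variable {K : Type*} [NormedAddCommGroup K] [InnerProductSpace ℂ K]

/-- The hypotheses under which forms are treated: continuity and symmetry of the factors. -/
structure Regular (f : ℝ → Word → K) (F G : ℝ → Word → Word → Word → K →L[ℂ] K)
    (g : ℝ → Word → K) : Prop where
  left : IsFamily f
  fst : IsC0 F
  snd : IsC0 G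
  right : IsFamily g

variable {f g : ℝ → Word → K} {F G : ℝ → Word → Word → Word → K →L[ℂ] K}

namespace Regular

theorem formNorm_eq (h : Regular f F G g) (t : ℝ) : formNorm (f t) (F t) (G t) (g t) =
    ∫⁻ w, normIntegrand (f t) (F t) (G t) (g t) w.words ∂conf :=
  (symmAll_normIntegrand (h.left.symm t) (h.fst.symm₃_apply t) (h.snd.symm₃_apply t)
    (h.right.symm t)).lintegral_mMeasure

theorem form_eq (h : Regular f F G g) {t : ℝ}
    (H : Integrable (fun w => integrand (f t) (F t) (G t) (g t) w.words) conf) :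
    form (f t) (F t) (G t) (g t) = ∫ w, integrand (f t) (F t) (G t) (g t) w.words ∂conf :=
  (symmAll_integrand (h.left.symm t) (h.fst.symm₃_apply t) (h.snd.symm₃_apply t)
    (h.right.symm t)).integral_complex H

theorem aestronglyMeasurable_integrand (h : Regular f F G g) :
    AEStronglyMeasurable (fun p : ℝ × Conf =>
      integrand (f p.1) (F p.1) (G p.1) (g p.1) p.2.words) (volume.prod conf) := by
  have h1 := h.fst.aestronglyMeasurable separate_one
  have h2 := h.snd.aestronglyMeasurable separate_two
  have h3 := h.left.aestronglyMeasurable 0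
  have h4 := h.right.aestronglyMeasurable 7
  have happ : Continuous fun q : (K →L[ℂ] K) × K => q.1 q.2 := by fun_prop
  exact h3.inner (happ.comp_aestronglyMeasurable
    (h1.prodMk (happ.comp_aestronglyMeasurable (h2.prodMk h4))))

theorem aemeasurable_normIntegrand (h : Regular f F G g) :
    AEMeasurable (fun p : ℝ × Conf =>
      normIntegrand (f p.1) (F p.1) (G p.1) (g p.1) p.2.words) (volume.prod conf) := by
  have h1 := h.fst.aestronglyMeasurable separate_one
  have h2 := h.snd.aestronglyMeasurable separate_two
  have hcomp : Continuous fun q : (K →L[ℂ] K) × (K →L[ℂ] K) => q.1 ∘L q.2 := by fun_prop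
  exact ((h.left.aestronglyMeasurable 0).enorm.mul
    (hcomp.comp_aestronglyMeasurable (h1.prodMk h2)).enorm).mul
      (h.right.aestronglyMeasurable 7).enorm

theorem aestronglyMeasurable_normIntegrand (h : Regular f F G g) :
    AEStronglyMeasurable (fun p : ℝ × Conf =>
      normIntegrand (f p.1) (F p.1) (G p.1) (g p.1) p.2.words) (volume.prod conf) :=
  h.aemeasurable_normIntegrand.aestronglyMeasurable

theorem aemeasurable_formNorm (h : Regular f F G g) :
    AEMeasurable fun t => formNorm (f t) (F t) (G t) (g t) := by
  simp_rw [h.formNorm_eq]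
  exact h.aemeasurable_normIntegrand.lintegral_prod_right'

/-- A finite integral forces finiteness almost everywhere on each `[-n, n]`, and countably many of
these intervals cover the line. -/
theorem ae_formNorm_lt_top (h : Regular f F G g) (hl : LocIntegrableInNorm f F G g) :
    ∀ᵐ t, formNorm (f t) (F t) (G t) (g t) < ⊤ := by
  have h1 : ∀ n : ℕ, ∀ᵐ t ∂volume.restrict (Set.Icc (-n : ℝ) n),
      formNorm (f t) (F t) (G t) (g t) < ⊤ := fun n =>
    ae_lt_top' h.aemeasurable_formNorm.restrict (hl _ isCompact_Icc).ne
  have h2 : ∀ᵐ t, ∀ n : ℕ, t ∈ Set.Icc (-n : ℝ) n → formNorm (f t) (F t) (G t) (g t) < ⊤ :=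
    ae_all_iff.2 fun n => (ae_restrict_iff' measurableSet_Icc).1 (h1 n)
  filter_upwards [h2] with t ht
  obtain ⟨n, hn⟩ := exists_nat_ge |t|
  exact ht n (abs_le.1 hn)

theorem ae_integrable (h : Regular f F G g) (hl : LocIntegrableInNorm f F G g) :
    ∀ᵐ t, Integrable (fun w => integrand (f t) (F t) (G t) (g t) w.words) conf := by
  filter_upwards [h.ae_formNorm_lt_top hl,
    h.aestronglyMeasurable_integrand.prodMk_left] with t h1 h2
  refine ⟨h2, ?_⟩
  rw [h.formNorm_eq] at h1
  exact (lintegral_mono fun w => enorm_integrand_le _ _ _ _ _).trans_lt h1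

theorem ae_form_eq (h : Regular f F G g) (hl : LocIntegrableInNorm f F G g) :
    ∀ᵐ t, form (f t) (F t) (G t) (g t) =
      ∫ w, integrand (f t) (F t) (G t) (g t) w.words ∂conf := by
  filter_upwards [h.ae_integrable hl] with t ht using h.form_eq ht

theorem locallyIntegrable_form (h : Regular f F G g) (hl : LocIntegrableInNorm f F G g) :
    LocallyIntegrable fun t => form (f t) (F t) (G t) (g t) := by
  rw [locallyIntegrable_iff]
  intro C hC
  refine ⟨?_, ?_⟩
  · refine AEStronglyMeasurable.restrict ?_
    exact h.aestronglyMeasurable_integrand.integral_prod_right'.congr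
      ((h.ae_form_eq hl).mono fun t ht => ht.symm)
  -- The bound holds for every `t`, including those where the form does not exist in norm.
  · refine (lintegral_mono fun t => ?_).trans_lt (hl C hC)
    exact (enorm_integral_le_lintegral_enorm _).trans
      (lintegral_mono fun z => enorm_integrand_le _ _ _ _ z)

/-- The gateway to Fubini: `ψ` is bounded and confines `t` to a compact set, where local
integrability in norm bounds the double integral. -/
theorem integrable_mul (h : Regular f F G g) (hl : LocIntegrableInNorm f F G g) {ψ : ℝ → ℂ}
    (hψ : Continuous ψ) (hψc : HasCompactSupport ψ) : Integrable (fun p : ℝ × Conf =>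
      ψ p.1 * integrand (f p.1) (F p.1) (G p.1) (g p.1) p.2.words) (volume.prod conf) := by
  have hψm : AEStronglyMeasurable (fun p : ℝ × Conf => ψ p.1) (volume.prod conf) :=
    (hψ.aestronglyMeasurable (μ := volume)).comp_fst
  refine ⟨hψm.mul h.aestronglyMeasurable_integrand, ?_⟩
  obtain ⟨M, hM⟩ := hψ.bounded_above_of_compact_support hψc
  have h1 : AEMeasurable (fun p : ℝ × Conf =>
      ‖ψ p.1‖ₑ * normIntegrand (f p.1) (F p.1) (G p.1) (g p.1) p.2.words) (volume.prod conf) :=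
    hψm.enorm.mul h.aemeasurable_normIntegrand
  calc ∫⁻ p, ‖ψ p.1 * integrand (f p.1) (F p.1) (G p.1) (g p.1) p.2.words‖ₑ ∂volume.prod conf
      ≤ ∫⁻ p, ‖ψ p.1‖ₑ * normIntegrand (f p.1) (F p.1) (G p.1) (g p.1) p.2.words
          ∂volume.prod conf := by
        refine lintegral_mono fun p => ?_
        rw [enorm_mul]
        gcongr
        exact enorm_integrand_le _ _ _ _ _
    _ = ∫⁻ t, ‖ψ t‖ₑ * formNorm (f t) (F t) (G t) (g t) := by
        rw [lintegral_prod _ h1]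
        congr 1
        funext t
        rw [h.formNorm_eq]
        exact lintegral_const_mul' _ _ (enorm_ne_top (x := ψ t))
    _ ≤ ∫⁻ t, (tsupport ψ).indicator
          (fun t => ENNReal.ofReal M * formNorm (f t) (F t) (G t) (g t)) t := by
        refine lintegral_mono fun t => ?_
        by_cases ht : t ∈ tsupport ψ
        · rw [Set.indicator_of_mem ht]
          gcongr
          rw [← ofReal_norm]
          exact ENNReal.ofReal_le_ofReal (hM t)
        · simp [image_eq_zero_of_notMem_tsupport ht]
    _ = ENNReal.ofReal M * ∫⁻ t in tsupport ψ, formNorm (f t) (F t) (G t) (g t) := by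
        rw [lintegral_indicator (isClosed_tsupport ψ).measurableSet,
          lintegral_const_mul' _ _ ENNReal.ofReal_ne_top]
    _ < ⊤ := ENNReal.mul_lt_top ENNReal.ofReal_lt_top (hl _ hψc)

theorem integral_mul_form (h : Regular f F G g) (hl : LocIntegrableInNorm f F G g) {ψ : ℝ → ℂ}
    (hψ : Continuous ψ) (hψc : HasCompactSupport ψ) :
    ∫ t, ψ t * form (f t) (F t) (G t) (g t) = ∫ p : ℝ × Conf,
      ψ p.1 * integrand (f p.1) (F p.1) (G p.1) (g p.1) p.2.words ∂volume.prod conf := by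
  rw [integral_prod _ (h.integrable_mul hl hψ hψc)]
  refine integral_congr_ae ?_
  filter_upwards [h.ae_form_eq hl] with t ht
  rw [ht, integral_const_mul]

end Regular

/-! ### Local integrability in norm -/

theorem Symm.sub {A : Type*} [AddGroup A] {f g : Word → A} (hf : Symm f) (hg : Symm g) :
    Symm fun w => f w - g w := fun n w p => by
  simp only [hf n w p, hg n w p]

theorem IsC0.sub {A : Type*} [NormedAddCommGroup A] {F G : ℝ → Word → Word → Word → A}
    (hF : IsC0 F) (hG : IsC0 G) : IsC0 fun t σ τ υ => F t σ τ υ - G t σ τ υ where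
  symm₁ t τ υ := (hF.symm₁ t τ υ).sub (hG.symm₁ t τ υ)
  symm₂ t σ υ := (hF.symm₂ t σ υ).sub (hG.symm₂ t σ υ)
  symm₃ t σ τ := (hF.symm₃ t σ τ).sub (hG.symm₃ t σ τ)
  locInt := hF.locInt.sub hG.locInt
  cont := hF.cont.sub hG.cont

variable {F' G' F'' G'' : ℝ → Word → Word → Word → K →L[ℂ] K}

theorem LocIntegrableInNorm.of_le_add (h : Regular f F G g)
    (h' : Regular f F' G' g) (hl' : LocIntegrableInNorm f F' G' g)
    (h'' : Regular f F'' G'' g) (hl'' : LocIntegrableInNorm f F'' G'' g)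
    (hle : ∀ t z, normIntegrand (f t) (F t) (G t) (g t) z ≤
      normIntegrand (f t) (F' t) (G' t) (g t) z + normIntegrand (f t) (F'' t) (G'' t) (g t) z) :
    LocIntegrableInNorm f F G g := by
  have h1 : ∀ᵐ t, formNorm (f t) (F t) (G t) (g t) ≤
      formNorm (f t) (F' t) (G' t) (g t) + formNorm (f t) (F'' t) (G'' t) (g t) := by
    filter_upwards [h'.aestronglyMeasurable_normIntegrand.prodMk_left] with t ht
    rw [h.formNorm_eq, h'.formNorm_eq, h''.formNorm_eq, ← lintegral_add_left' ht.aemeasurable]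
    exact lintegral_mono fun w => hle t _
  intro C hC
  refine (lintegral_mono_ae (ae_restrict_of_ae h1)).trans_lt ?_
  rw [lintegral_add_left' h'.aemeasurable_formNorm.restrict]
  exact ENNReal.add_lt_top.2 ⟨hl' C hC, hl'' C hC⟩

theorem LocIntegrableInNorm.sub_fst (h' : Regular f F' G g) (hl' : LocIntegrableInNorm f F' G g)
    (h'' : Regular f F'' G g) (hl'' : LocIntegrableInNorm f F'' G g) :
    LocIntegrableInNorm f (fun t σ τ υ => F' t σ τ υ - F'' t σ τ υ) G g := by
  refine LocIntegrableInNorm.of_le_add ⟨h'.left, h'.fst.sub h''.fst, h'.snd, h'.right⟩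
    h' hl' h'' hl'' fun t z => ?_
  simp only [normIntegrand]
  rw [ContinuousLinearMap.sub_comp, ← add_mul, ← mul_add]
  gcongr
  exact enorm_sub_le

theorem LocIntegrableInNorm.sub_snd (h' : Regular f F G' g) (hl' : LocIntegrableInNorm f F G' g)
    (h'' : Regular f F G'' g) (hl'' : LocIntegrableInNorm f F G'' g) :
    LocIntegrableInNorm f F (fun t σ τ υ => G' t σ τ υ - G'' t σ τ υ) g := by
  refine LocIntegrableInNorm.of_le_add ⟨h'.left, h'.fst, h'.snd.sub h''.snd, h'.right⟩
    h' hl' h'' hl'' fun t z => ?_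
  simp only [normIntegrand]
  rw [ContinuousLinearMap.comp_sub, ← add_mul, ← mul_add]
  gcongr
  exact enorm_sub_le

theorem LocIntegrableInNorm.mono {f' g' : ℝ → Word → K} (h : LocIntegrableInNorm f F G g)
    (hf : ∀ t w, ‖f' t w‖ ≤ ‖f t w‖) (hg : ∀ t w, ‖g' t w‖ ≤ ‖g t w‖) :
    LocIntegrableInNorm f' F G g' := by
  intro C hC
  refine (lintegral_mono fun t => lintegral_mono fun z => ?_).trans_lt (h C hC)
  exact mul_le_mul' (mul_le_mul' (enorm_le_iff_norm_le.2 (hf _ _)) le_rfl)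
    (enorm_le_iff_norm_le.2 (hg _ _))

/-! ### A test function that dominates `a(t) f` -/

/-- A continuous function that is `1` on `[-R, R]` and vanishes outside of `[-R-1, R+1]`. -/
def plateau (R s : ℝ) : ℝ := max 0 (min 1 (R + 1 - |s|))

theorem continuous_plateau (R : ℝ) : Continuous (plateau R) := by
  unfold plateau
  fun_prop

theorem plateau_eq_one {R s : ℝ} (h : |s| ≤ R) : plateau R s = 1 := by
  rw [plateau, min_eq_left (by linarith), max_eq_right zero_le_one]

theorem abs_le_of_plateau_ne_zero {R s : ℝ} (h : plateau R s ≠ 0) : |s| ≤ R + 1 := by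
  by_contra h'
  apply h
  rw [plateau, max_eq_left]
  exact (min_le_right _ _).trans (by linarith)

/-- The constant vector `e`, cut off to words of at most `n₀` letters in `[-R-1, R+1]`. -/
def cutoff (n₀ : ℕ) (R : ℝ) (e : K) (w : Word) : K :=
  if w.1 ≤ n₀ then ((∏ i, plateau R (w.2 i) : ℝ) : ℂ) • e else 0

theorem isTest_cutoff (n₀ : ℕ) (R : ℝ) (e : K) : IsTest (cutoff n₀ R e) where
  symm n w p := by
    simp only [cutoff]
    rw [← Equiv.prod_comp p fun i => plateau R (w i)]
    rfl
  cont := by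
    refine continuous_sigma fun n => ?_
    by_cases h : n ≤ n₀
    · simp only [cutoff, h, if_true]
      have h1 : Continuous fun w : Fin n → ℝ => ∏ i, plateau R (w i) :=
        continuous_finsetProd _ fun i _ => (continuous_plateau R).comp (continuous_apply i)
      exact (Complex.continuous_ofReal.comp h1).smul continuous_const
    · simp only [cutoff, h, if_false]
      exact continuous_const
  supp := by
    refine HasCompactSupport.of_support_subset_isCompact
      (K := ⋃ n ∈ {n | n ≤ n₀}, (Sigma.mk n '' Metric.closedBall (0 : Fin n → ℝ) |R + 1| : Set Word))
      ((Set.finite_le_nat n₀).isCompact_biUnion fun n _ =>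
        (isCompact_closedBall _ _).image continuous_sigmaMk) ?_
    rintro ⟨n, w⟩ hw
    simp only [Function.mem_support, cutoff, ne_eq, ite_eq_right_iff, Classical.not_imp] at hw
    obtain ⟨h1, h2⟩ := hw
    refine Set.mem_biUnion (show n ∈ {n | n ≤ n₀} from h1) ⟨w, ?_, rfl⟩
    rw [mem_closedBall_zero_iff, pi_norm_le_iff_of_nonneg (abs_nonneg _)]
    intro i
    have h3 : (∏ i, plateau R (w i)) ≠ 0 := fun h => h2 (by rw [h]; simp)
    exact (abs_le_of_plateau_ne_zero (Finset.prod_ne_zero_iff.1 h3 i (Finset.mem_univ i))).trans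
      (le_abs_self _)

/-- The compact support of `f` bounds both the number and the size of the letters, and removing a
letter preserves these bounds. A cutoff of a constant vector of norm `sup ‖f‖` or more therefore
dominates uniformly in `t`. -/
theorem IsTest.exists_dominating {f : Word → K} (hf : IsTest f) :
    ∃ f' : Word → K, IsTest f' ∧ ∀ t w, ‖annih t f w‖ ≤ ‖f' w‖ := by
  by_cases h0 : ∀ w, f w = 0
  · exact ⟨f, hf, fun t w => by simp [annih, h0]⟩
  push Not at h0
  obtain ⟨w₀, hw₀⟩ := h0
  obtain ⟨M, hM⟩ := hf.cont.bounded_above_of_compact_support hf.supp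
  have hfst : Continuous (Sigma.fst : Word → ℕ) := continuous_sigma fun n => continuous_const
  have hnorm : Continuous fun w : Word => ‖w.2‖ := continuous_sigma fun n => continuous_norm
  obtain ⟨n₀, hn₀⟩ := (hf.supp.image hfst).bddAbove
  obtain ⟨R, hR⟩ := (hf.supp.image hnorm).bddAbove
  -- A vector of norm `M` must be exhibited, and a nonzero value of `f` is the only one at hand,
  -- since `K` may be trivial.
  refine ⟨cutoff n₀ R (((M / ‖f w₀‖ : ℝ) : ℂ) • f w₀), isTest_cutoff _ _ _, fun t w => ?_⟩
  by_cases hz : f (Word.add t w) = 0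
  · simp [annih, hz]
  have hs : Word.add t w ∈ tsupport f := subset_tsupport f hz
  have h1 : w.1 ≤ n₀ := (Nat.le_succ _).trans (hn₀ ⟨_, hs, rfl⟩)
  have h2 : ∀ i, |w.2 i| ≤ R := fun i => by
    have h3 : ‖(Word.add t w).2‖ ≤ R := hR ⟨_, hs, rfl⟩
    have h4 := (norm_le_pi_norm (Word.add t w).2 i.succ).trans h3
    exact h4
  have hpos : 0 < ‖f w₀‖ := norm_pos_iff.2 hw₀
  have hM0 : 0 ≤ M := (norm_nonneg _).trans (hM w₀)
  rw [cutoff, if_pos h1, Finset.prod_congr rfl fun i _ => plateau_eq_one (h2 i)]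
  rw [Finset.prod_const_one, Complex.ofReal_one, one_smul, norm_smul, Complex.norm_real,
    Real.norm_of_nonneg (by positivity), div_mul_cancel₀ _ hpos.ne']
  exact hM _

end Families

/-! ### Derivatives and jumps along the line for a fixed configuration -/

section Pointwise

/-- The argument among three that has a mark. -/
def markOpt (a b d : Bool) : Option SignType :=
  if a then some 1 else if b then some 0 else if d then some (-1) else none

/-- Add the point `t` to the marked argument, if there is one. -/
def addOpt {A : Type*} [NormedAddCommGroup A] (o : Option SignType) (t : ℝ)
    (F : Word → Word → Word → A) : Word → Word → Word → A :=
  o.elim F fun i => addPoint i t F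

theorem addIf_eq_addOpt {A : Type*} [NormedAddCommGroup A] (F : Word → Word → Word → A) (t : ℝ)
    {a b d : Bool} (h : ¬(a ∧ b) ∧ ¬(a ∧ d) ∧ ¬(b ∧ d)) (σ τ υ : Word) :
    F (Word.addIf a t σ) (Word.addIf b t τ) (Word.addIf d t υ) =
      addOpt (markOpt a b d) t F σ τ υ := by
  cases a <;> cases b <;> cases d <;> first | rfl | simp at h

/-- `R^i_+ x`, or `x` itself if no argument is marked. -/
def plusPart {A : Type*} [NormedAddCommGroup A] (o : Option SignType)
    (x : ℝ → Word → Word → Word → A) : ℝ → Word → Word → Word → A :=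
  o.elim x fun i => Rplus i x

/-- `R^i_- x`, or `x` itself if no argument is marked. -/
def minusPart {A : Type*} [NormedAddCommGroup A] (o : Option SignType)
    (x : ℝ → Word → Word → Word → A) : ℝ → Word → Word → Word → A :=
  o.elim x fun i => Rminus i x

theorem IsC1.tendsto_plusPart {A : Type*} [NormedAddCommGroup A] [NormedSpace ℝ A]
    {x : ℝ → Word → Word → Word → A} (hx : IsC1 x) (o : Option SignType) {t : ℝ} {σ τ υ : Word}
    (h : (t, σ, τ, υ) ∈ Distinct) :
    Tendsto (fun u => addOpt o t (x u) σ τ υ) (𝓝[>] t) (𝓝 (plusPart o x t σ τ υ)) := by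
  cases o with
  | none => exact (hx.diff t σ τ υ h).continuousAt.tendsto.mono_left nhdsWithin_le_nhds
  | some i => exact tendsto_nhds_limUnder (hx.right i t σ τ υ h)

theorem IsC1.tendsto_minusPart {A : Type*} [NormedAddCommGroup A] [NormedSpace ℝ A]
    {x : ℝ → Word → Word → Word → A} (hx : IsC1 x) (o : Option SignType) {t : ℝ} {σ τ υ : Word}
    (h : (t, σ, τ, υ) ∈ Distinct) :
    Tendsto (fun u => addOpt o t (x u) σ τ υ) (𝓝[<] t) (𝓝 (minusPart o x t σ τ υ)) := by
  cases o with
  | none => exact (hx.diff t σ τ υ h).continuousAt.tendsto.mono_left nhdsWithin_le_nhds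
  | some i => exact tendsto_nhds_limUnder (hx.left i t σ τ υ h)

/-- `a(t) f` if the chain meets the outer word, and `f` otherwise. -/
def annihIf {K : Type*} (b : Bool) (f : Word → K) (t : ℝ) : Word → K := if b then annih t f else f

/-- The mark of a chain in the first operator. -/
def mark₁ (c : Fin 11) : Option SignType := markOpt (mem c 1) (mem c 2) (mem c 3)

/-- The mark of a chain in the second operator. -/
def mark₂ (c : Fin 11) : Option SignType := markOpt (mem c 4) (mem c 5) (mem c 6)

variable {K : Type*} [NormedAddCommGroup K] [InnerProductSpace ℂ K]
  {x y : ℝ → Word → Word → Word → K →L[ℂ] K} {f g : Word → K}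

/-- A new point of type `c` becomes a letter of exactly the words met by `c`. Each operator receives
it in at most one argument, by `separate_one` and `separate_two`. -/
theorem integrand_insert {F G : Word → Word → Word → K →L[ℂ] K} (hf : Symm f) (hF : Symm₃ F)
    (hG : Symm₃ G) (hg : Symm g) (w : Conf) (i : Fin (w.1.1 + 1)) (c : Fin 11) (t : ℝ) :
    integrand f F G g (w.insert i c t).words = integrand (annihIf (mem c 0) f t)
      (addOpt (mark₁ c) t F) (addOpt (mark₂ c) t G) (annihIf (mem c 7) g t) w.words := by
  have hfam : ∀ (b : Bool) (f : Word → K) (w : Word),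
      f (Word.addIf b t w) = annihIf b f t w := by
    intro b f w
    cases b <;> rfl
  rw [symmAll_integrand hf hF hG hg _ _ (w.words_insert i c t), integrand, integrand,
    addIf_eq_addOpt F t (separate_one c), addIf_eq_addOpt G t (separate_two c), hfam (mem c 0) f, hfam (mem c 7) g]
  rfl

/-- The jump of the integrand at a point `t` of type `c`. -/
def jumpKernel (x y : ℝ → Word → Word → Word → K →L[ℂ] K) (f g : Word → K) (c : Fin 11) (t : ℝ)
    (w : Conf) : ℂ :=
  integrand (annihIf (mem c 0) f t) (plusPart (mark₁ c) x t) (plusPart (mark₂ c) y t)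
    (annihIf (mem c 7) g t) w.words -
  integrand (annihIf (mem c 0) f t) (minusPart (mark₁ c) x t) (minusPart (mark₂ c) y t)
    (annihIf (mem c 7) g t) w.words

theorem tendsto_integrand {l : Filter ℝ} {F G : ℝ → Word → Word → Word → K →L[ℂ] K}
    {F' G' : Word → Word → Word → K →L[ℂ] K} {z : Fin 8 → Word} (f g : Word → K)
    (hF : Tendsto (fun u => F u (z 1) (z 2) (z 3)) l (𝓝 (F' (z 1) (z 2) (z 3))))
    (hG : Tendsto (fun u => G u (z 4) (z 5) (z 6)) l (𝓝 (G' (z 4) (z 5) (z 6)))) :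
    Tendsto (fun u => integrand f (F u) (G u) g z) l (𝓝 (integrand f F' G' g z)) := by
  have happ : Continuous fun q : (K →L[ℂ] K) × K => q.1 q.2 := by fun_prop
  exact tendsto_const_nhds.inner ((happ.tendsto _).comp
    (hF.prodMk_nhds ((happ.tendsto _).comp (hG.prodMk_nhds tendsto_const_nhds))))

theorem Conf.insert_remove {N : ℕ} (c : Fin (N + 1) → Fin 11) (v : Fin (N + 1) → ℝ)
    (i : Fin (N + 1)) : Conf.insert ⟨⟨N, fun j => c (i.succAbove j)⟩, fun j => v (i.succAbove j)⟩ i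
      (c i) (v i) = ⟨⟨N + 1, c⟩, v⟩ := by
  have h1 : i.insertNth (c i) (fun j => c (i.succAbove j)) = c := Fin.insertNth_self_removeNth i c
  have h2 : i.insertNth (v i) (fun j => v (i.succAbove j)) = v := Fin.insertNth_self_removeNth i v
  simp only [Conf.insert]
  rw [h2]
  congr 1
  rw [h1]

theorem apart_remove {N : ℕ} {c : Fin (N + 1) → Fin 11} {v : Fin (N + 1) → ℝ}
    (hv : Function.Injective v) (i : Fin (N + 1)) :
    Apart (v i) ⟨⟨N, fun j => c (i.succAbove j)⟩, fun j => v (i.succAbove j)⟩ :=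
  ⟨hv.comp Fin.succAbove_right_injective, fun j h => Fin.succAbove_ne i j (hv h)⟩

/-- The point `v i` is taken out of the configuration and inserted again. It then stands as an added
letter in the marked arguments while the time of `x` and `y` tends to it, which is the situation of
`R^j_+`; an unmarked operator is simply continuous there. -/
theorem tendsto_right (hx : IsC1 x) (hy : IsC1 y) (hf : Symm f) (hg : Symm g) {N : ℕ}
    {c : Fin (N + 1) → Fin 11} {v : Fin (N + 1) → ℝ} (hv : Function.Injective v)
    (i : Fin (N + 1)) :
    Tendsto (fun u => integrand f (x u) (y u) g (Conf.words ⟨⟨N + 1, c⟩, v⟩)) (𝓝[>] (v i))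
      (𝓝 (integrand (annihIf (mem (c i) 0) f (v i)) (plusPart (mark₁ (c i)) x (v i))
        (plusPart (mark₂ (c i)) y (v i)) (annihIf (mem (c i) 7) g (v i))
        (Conf.words ⟨⟨N, fun j => c (i.succAbove j)⟩, fun j => v (i.succAbove j)⟩))) := by
  have hA := apart_remove (c := c) hv i
  simp_rw [← Conf.insert_remove c v i, integrand_insert hf (hx.isC0.symm₃_apply _)
    (hy.isC0.symm₃_apply _) hg]
  exact tendsto_integrand (F := fun u => addOpt (mark₁ (c i)) (v i) (x u))
    (G := fun u => addOpt (mark₂ (c i)) (v i) (y u)) _ _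
    (hx.tendsto_plusPart _ (hA.distinct separate_one))
    (hy.tendsto_plusPart _ (hA.distinct separate_two))

theorem tendsto_left (hx : IsC1 x) (hy : IsC1 y) (hf : Symm f) (hg : Symm g) {N : ℕ}
    {c : Fin (N + 1) → Fin 11} {v : Fin (N + 1) → ℝ} (hv : Function.Injective v)
    (i : Fin (N + 1)) :
    Tendsto (fun u => integrand f (x u) (y u) g (Conf.words ⟨⟨N + 1, c⟩, v⟩)) (𝓝[<] (v i))
      (𝓝 (integrand (annihIf (mem (c i) 0) f (v i)) (minusPart (mark₁ (c i)) x (v i))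
        (minusPart (mark₂ (c i)) y (v i)) (annihIf (mem (c i) 7) g (v i))
        (Conf.words ⟨⟨N, fun j => c (i.succAbove j)⟩, fun j => v (i.succAbove j)⟩))) := by
  have hA := apart_remove (c := c) hv i
  simp_rw [← Conf.insert_remove c v i, integrand_insert hf (hx.isC0.symm₃_apply _)
    (hy.isC0.symm₃_apply _) hg]
  exact tendsto_integrand (F := fun u => addOpt (mark₁ (c i)) (v i) (x u))
    (G := fun u => addOpt (mark₂ (c i)) (v i) (y u)) _ _
    (hx.tendsto_minusPart _ (hA.distinct separate_one))
    (hy.tendsto_minusPart _ (hA.distinct separate_two))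

theorem hasDerivAt_clm_apply {X : ℝ → K →L[ℂ] K} {X' : K →L[ℂ] K} {v : ℝ → K} {v' : K} {t : ℝ}
    (hX : HasDerivAt X X' t) (hv : HasDerivAt v v' t) :
    HasDerivAt (fun u => X u (v u)) (X' (v t) + X t v') t :=
  ((ContinuousLinearMap.restrictScalarsL ℂ K K ℝ ℝ).hasFDerivAt.comp_hasDerivAt t hX).clm_apply hv

theorem hasDerivAt_integrand (hx : IsC1 x) (hy : IsC1 y) (f g : Word → K) {t : ℝ} {w : Conf}
    (h : Apart t w) : HasDerivAt (fun u => integrand f (x u) (y u) g w.words)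
      (integrand f (dc x t) (y t) g w.words + integrand f (x t) (dc y t) g w.words) t := by
  have h1 := (hx.diff _ _ _ _ (h.distinct separate_one)).hasDerivAt
  have h2 := (hy.diff _ _ _ _ (h.distinct separate_two)).hasDerivAt
  have h3 := hasDerivAt_clm_apply h1
    (hasDerivAt_clm_apply h2 (hasDerivAt_const t (g (w.words 7))))
  have h4 := ((innerSL ℂ (f (w.words 0))).restrictScalars ℝ).hasFDerivAt.comp_hasDerivAt t h3
  convert! h4 using 1
  simp [integrand, dc, inner_add_right]

/-- The integrand on the left is the derivative of `φ` times the form's integrand away from the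
points of `w`, so its integral is minus the sum of the jumps. -/
theorem integral_eq_pointSum (hx : IsC1 x) (hy : IsC1 y) (hf : Symm f) (hg : Symm g) {φ : ℝ → ℂ}
    (hφ : ContDiff ℝ ∞ φ) (hφc : HasCompactSupport φ) {w : Conf} (hw : Function.Injective w.2)
    (hi : Integrable fun t => deriv φ t * integrand f (x t) (y t) g w.words +
      (φ t * integrand f (dc x t) (y t) g w.words +
        φ t * integrand f (x t) (dc y t) g w.words)) :
    ∫ t, (deriv φ t * integrand f (x t) (y t) g w.words +
      (φ t * integrand f (dc x t) (y t) g w.words +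
        φ t * integrand f (x t) (dc y t) g w.words)) =
      -pointSum (fun c t w => φ t * jumpKernel x y f g c t w) w := by
  classical
  obtain ⟨⟨N, c⟩, v⟩ := w
  have hd : ∀ t ∉ Finset.univ.image v,
      HasDerivAt (fun t => φ t * integrand f (x t) (y t) g (Conf.words ⟨⟨N, c⟩, v⟩))
        (deriv φ t * integrand f (x t) (y t) g (Conf.words ⟨⟨N, c⟩, v⟩) +
          (φ t * integrand f (dc x t) (y t) g (Conf.words ⟨⟨N, c⟩, v⟩) +
            φ t * integrand f (x t) (dc y t) g (Conf.words ⟨⟨N, c⟩, v⟩))) t := by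
    intro t ht
    have hA : Apart t ⟨⟨N, c⟩, v⟩ := ⟨hw, fun u hu =>
      ht (Finset.mem_image.2 ⟨u, Finset.mem_univ _, hu⟩)⟩
    have h1 : HasDerivAt φ (deriv φ t) t := (hφ.differentiable (by simp) t).hasDerivAt
    convert! h1.mul (hasDerivAt_integrand hx hy f g hA) using 1
    ring
  have hcs : HasCompactSupport fun t =>
      φ t * integrand f (x t) (y t) g (Conf.words ⟨⟨N, c⟩, v⟩) := hφc.mul_right
  cases N with
  | zero =>
    have := integral_deriv_of_jumps (P := Finset.univ.image v) (L := 0) (R := 0) hcs hd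
      (by simp) (by simp) hi
    rw [this]
    simp [pointSum]
  | succ N =>
    have hφt : ∀ t, Tendsto φ (𝓝 t) (𝓝 (φ t)) := fun t => hφ.continuous.tendsto t
    have hR := fun i => ((hφt (v i)).mono_left nhdsWithin_le_nhds).mul
      (tendsto_right (c := c) hx hy hf hg hw i)
    have hL := fun i => ((hφt (v i)).mono_left nhdsWithin_le_nhds).mul
      (tendsto_left (c := c) hx hy hf hg hw i)
    -- The limits must be functions of the real number `p`, not of its index; `limUnder` provides
    -- them and injectivity of `v` later returns to a sum over indices.
    rw [integral_deriv_of_jumps (P := Finset.univ.image v)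
      (L := fun p => limUnder (𝓝[<] p) fun t =>
        φ t * integrand f (x t) (y t) g (Conf.words ⟨⟨N + 1, c⟩, v⟩))
      (R := fun p => limUnder (𝓝[>] p) fun t =>
        φ t * integrand f (x t) (y t) g (Conf.words ⟨⟨N + 1, c⟩, v⟩)) hcs hd ?_ ?_ hi]
    · rw [Finset.sum_image fun i _ j _ h => hw h, pointSum]
      congr 1
      refine Finset.sum_congr rfl fun i _ => ?_
      rw [(hR i).limUnder_eq, (hL i).limUnder_eq, jumpKernel, mul_sub]
    · intro p hp
      obtain ⟨i, _, rfl⟩ := Finset.mem_image.1 hp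
      exact tendsto_nhds_limUnder ⟨_, hL i⟩
    · intro p hp
      obtain ⟨i, _, rfl⟩ := Finset.mem_image.1 hp
      exact tendsto_nhds_limUnder ⟨_, hR i⟩

end Pointwise

/-! ### The Itô formula -/

section Families

variable {A : Type*} [NormedAddCommGroup A] [NormedSpace ℝ A] {x F : ℝ → Word → Word → Word → A}

theorem self_mem_family : x ∈ family x := Or.inl (Or.inl (Or.inl rfl))

theorem dc_mem_family : dc x ∈ family x := Or.inl (Or.inl (Or.inr rfl))

theorem plusPart_mem_family (o : Option SignType) : plusPart o x ∈ family x := by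
  cases o with
  | none => exact self_mem_family
  | some i => exact Or.inl (Or.inr ⟨i, rfl⟩)

theorem minusPart_mem_family (o : Option SignType) : minusPart o x ∈ family x := by
  cases o with
  | none => exact self_mem_family
  | some i => exact Or.inr ⟨i, rfl⟩

theorem IsC1.isC0_of_mem (hx : IsC1 x) (hF : F ∈ family x) : IsC0 F := by
  rcases hF with ((rfl | rfl) | ⟨i, rfl⟩) | ⟨i, rfl⟩
  exacts [hx.isC0, hx.dc_isC0, hx.right_isC0 i, hx.left_isC0 i]

theorem IsC1.isC0_of_memD (hx : IsC1 x) (hF : F ∈ familyD x) : IsC0 F := by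
  rcases hF with hF | ⟨i, rfl⟩
  · exact hx.isC0_of_mem hF
  · exact (hx.right_isC0 i).sub (hx.left_isC0 i)

end Families

section Main

variable {K : Type*} [NormedAddCommGroup K] [InnerProductSpace ℂ K]
  {x y : ℝ → Word → Word → Word → K →L[ℂ] K} {f g : Word → K}

theorem locIntegrableInNorm_familyD (hx : IsC1 x) (hy : IsC1 y)
    (hf : IsTest f) (hg : IsTest g)
    (hxy : ∀ F ∈ family x, ∀ G ∈ family y, LocIntegrableInNorm (fun _ => f) F G fun _ => g)
    {F G : ℝ → Word → Word → Word → K →L[ℂ] K} (hF : F ∈ familyD x) (hG : G ∈ familyD y) :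
    LocIntegrableInNorm (fun _ => f) F G fun _ => g := by
  have key : ∀ F ∈ familyD x, ∀ G ∈ family y, LocIntegrableInNorm (fun _ => f) F G fun _ => g := by
    rintro F (hF | ⟨i, rfl⟩) G hG
    · exact hxy F hF G hG
    · exact LocIntegrableInNorm.sub_fst
        ⟨hf.isFamily, hx.right_isC0 i, hy.isC0_of_mem hG, hg.isFamily⟩
        (hxy _ (plusPart_mem_family (some i)) G hG)
        ⟨hf.isFamily, hx.left_isC0 i, hy.isC0_of_mem hG, hg.isFamily⟩
        (hxy _ (minusPart_mem_family (some i)) G hG)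
  rcases hG with hG | ⟨i, rfl⟩
  · exact key F hF G hG
  · exact LocIntegrableInNorm.sub_snd
      ⟨hf.isFamily, hx.isC0_of_memD hF, hy.right_isC0 i, hg.isFamily⟩
      (key F hF _ (plusPart_mem_family (some i)))
      ⟨hf.isFamily, hx.isC0_of_memD hF, hy.left_isC0 i, hg.isFamily⟩
      (key F hF _ (minusPart_mem_family (some i)))

theorem IsTest.isFamily_annihIf {K : Type*} [NormedAddCommGroup K] {f : Word → K}
    (hf : IsTest f) (b : Bool) : IsFamily (annihIf b f) := by
  cases b
  · exact hf.isFamily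
  · exact hf.isFamily_annih

theorem IsTest.exists_dominating_annihIf (hf : IsTest f) (b : Bool) :
    ∃ f' : Word → K, IsTest f' ∧ ∀ t w, ‖annihIf b f t w‖ ≤ ‖f' w‖ := by
  cases b
  · exact ⟨f, hf, fun t w => le_rfl⟩
  · exact hf.exists_dominating

theorem locIntegrableInNorm_annihIf (hx : IsC1 x) (hy : IsC1 y)
    (hxy : ∀ f g : Word → K, IsTest f → IsTest g → ∀ F ∈ family x, ∀ G ∈ family y,
      LocIntegrableInNorm (fun _ => f) F G fun _ => g)
    (hf : IsTest f) (hg : IsTest g) (b d : Bool)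
    {F G : ℝ → Word → Word → Word → K →L[ℂ] K} (hF : F ∈ familyD x) (hG : G ∈ familyD y) :
    LocIntegrableInNorm (annihIf b f) F G (annihIf d g) := by
  obtain ⟨f', hf', hff⟩ := hf.exists_dominating_annihIf b
  obtain ⟨g', hg', hgg⟩ := hg.exists_dominating_annihIf d
  exact (locIntegrableInNorm_familyD hx hy hf' hg' (hxy f' g' hf' hg') hF hG).mono hff hgg

namespace Regular

variable {f g : ℝ → Word → K} {F F' G G' : ℝ → Word → Word → Word → K →L[ℂ] K}

/-- Splitting the integral needs both parts integrable, which local integrability in norm guarantees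
only for almost all `t`. -/
theorem ae_form_sub_fst (h : Regular f F G g) (hl : LocIntegrableInNorm f F G g)
    (h' : Regular f F' G g) (hl' : LocIntegrableInNorm f F' G g) :
    ∀ᵐ t, form (f t) (fun σ τ υ => F t σ τ υ - F' t σ τ υ) (G t) (g t) =
      form (f t) (F t) (G t) (g t) - form (f t) (F' t) (G t) (g t) := by
  filter_upwards [h.ae_integrable hl, h'.ae_integrable hl'] with t h1 h2
  have i1 := (symmAll_integrand (h.left.symm t) (h.fst.symm₃_apply t) (h.snd.symm₃_apply t)
    (h.right.symm t)).integrable h1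
  have i2 := (symmAll_integrand (h'.left.symm t) (h'.fst.symm₃_apply t) (h'.snd.symm₃_apply t)
    (h'.right.symm t)).integrable h2
  refine Eq.trans ?_ (integral_sub i1 i2)
  simp [form]

theorem ae_form_sub_snd (h : Regular f F G g) (hl : LocIntegrableInNorm f F G g)
    (h' : Regular f F G' g) (hl' : LocIntegrableInNorm f F G' g) :
    ∀ᵐ t, form (f t) (F t) (fun σ τ υ => G t σ τ υ - G' t σ τ υ) (g t) =
      form (f t) (F t) (G t) (g t) - form (f t) (F t) (G' t) (g t) := by
  filter_upwards [h.ae_integrable hl, h'.ae_integrable hl'] with t h1 h2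
  have i1 := (symmAll_integrand (h.left.symm t) (h.fst.symm₃_apply t) (h.snd.symm₃_apply t)
    (h.right.symm t)).integrable h1
  have i2 := (symmAll_integrand (h'.left.symm t) (h'.fst.symm₃_apply t) (h'.snd.symm₃_apply t)
    (h'.right.symm t)).integrable h2
  refine Eq.trans ?_ (integral_sub i1 i2)
  simp [form]

end Regular

/-- The term of the Itô formula that belongs to the chains of type `c`. -/
def jumpTerm (x y : ℝ → Word → Word → Word → K →L[ℂ] K) (f g : Word → K) (c : Fin 11) (t : ℝ) :
    ℂ :=
  form (annihIf (mem c 0) f t) (plusPart (mark₁ c) x t) (plusPart (mark₂ c) y t)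
    (annihIf (mem c 7) g t) -
  form (annihIf (mem c 0) f t) (minusPart (mark₁ c) x t) (minusPart (mark₂ c) y t)
    (annihIf (mem c 7) g t)

theorem ae_injective : ∀ᵐ w ∂conf, Function.Injective w.2 := by
  have h1 : ∀ᵐ t : ℝ, ∀ᵐ w ∂conf, Apart t w := Measure.ae_ae_of_ae_prod ae_apart
  obtain ⟨t, ht⟩ := h1.exists
  exact ht.mono fun w hw => hw.1

/-- The weak form of the theorem, still organised by types of chains. The double integral of the
derivative of `φ` times the integrand is evaluated in two orders: `t` outside gives integrals of
forms, `t` inside gives minus the sums of jumps. -/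
theorem neg_integral_form (hx : IsC1 x) (hy : IsC1 y)
    (hxy : ∀ f g : Word → K, IsTest f → IsTest g → ∀ F ∈ family x, ∀ G ∈ family y,
      LocIntegrableInNorm (fun _ => f) F G fun _ => g)
    (hf : IsTest f) (hg : IsTest g) {φ : ℝ → ℂ} (hφ : ContDiff ℝ ∞ φ)
    (hφc : HasCompactSupport φ) :
    -∫ t, form f (x t) (y t) g * deriv φ t =
      (∫ t, φ t * form f (dc x t) (y t) g) + (∫ t, φ t * form f (x t) (dc y t) g) +
        ∑ c, ∫ t, φ t * jumpTerm x y f g c t := by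
  have hφ' : Continuous (deriv φ) := hφ.continuous_deriv (by simp)
  have hφc' : HasCompactSupport (deriv φ) := hφc.deriv
  have r0 : Regular (fun _ => f) x y fun _ => g := ⟨hf.isFamily, hx.isC0, hy.isC0, hg.isFamily⟩
  have r1 : Regular (fun _ => f) (dc x) y fun _ => g :=
    ⟨hf.isFamily, hx.dc_isC0, hy.isC0, hg.isFamily⟩
  have r2 : Regular (fun _ => f) x (dc y) fun _ => g :=
    ⟨hf.isFamily, hx.isC0, hy.dc_isC0, hg.isFamily⟩
  have l0 := hxy f g hf hg _ self_mem_family _ self_mem_family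
  have l1 := hxy f g hf hg _ dc_mem_family _ self_mem_family
  have l2 := hxy f g hf hg _ self_mem_family _ dc_mem_family
  have rp : ∀ c, Regular (annihIf (mem c 0) f) (plusPart (mark₁ c) x) (plusPart (mark₂ c) y)
      (annihIf (mem c 7) g) := fun c =>
    ⟨hf.isFamily_annihIf _, hx.isC0_of_mem (plusPart_mem_family _),
      hy.isC0_of_mem (plusPart_mem_family _), hg.isFamily_annihIf _⟩
  have rm : ∀ c, Regular (annihIf (mem c 0) f) (minusPart (mark₁ c) x) (minusPart (mark₂ c) y)
      (annihIf (mem c 7) g) := fun c =>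
    ⟨hf.isFamily_annihIf _, hx.isC0_of_mem (minusPart_mem_family _),
      hy.isC0_of_mem (minusPart_mem_family _), hg.isFamily_annihIf _⟩
  have lp := fun c => locIntegrableInNorm_annihIf hx hy hxy hf hg (mem c 0) (mem c 7)
    (Or.inl (plusPart_mem_family (mark₁ c))) (Or.inl (plusPart_mem_family (mark₂ c)))
  have lm := fun c => locIntegrableInNorm_annihIf hx hy hxy hf hg (mem c 0) (mem c 7)
    (Or.inl (minusPart_mem_family (mark₁ c))) (Or.inl (minusPart_mem_family (mark₂ c)))
  have i0 := r0.integrable_mul l0 hφ' hφc'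
  have i1 := r1.integrable_mul l1 hφ.continuous hφc
  have i2 := r2.integrable_mul l2 hφ.continuous hφc
  have ip := fun c => (rp c).integrable_mul (lp c) hφ.continuous hφc
  have im := fun c => (rm c).integrable_mul (lm c) hφ.continuous hφc
  have hQ : Integrable (fun p : ℝ × Conf => deriv φ p.1 * integrand f (x p.1) (y p.1) g p.2.words +
      (φ p.1 * integrand f (dc x p.1) (y p.1) g p.2.words +
        φ p.1 * integrand f (x p.1) (dc y p.1) g p.2.words)) (volume.prod conf) :=
    i0.add (i1.add i2)
  have hk : ∀ c, Integrable (fun p : ℝ × Conf => φ p.1 * jumpKernel x y f g c p.1 p.2)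
      (volume.prod conf) := fun c => by
    simp only [jumpKernel, mul_sub]
    exact (ip c).sub (im c)
  have hpt : (fun w => ∫ t, (deriv φ t * integrand f (x t) (y t) g w.words +
      (φ t * integrand f (dc x t) (y t) g w.words +
        φ t * integrand f (x t) (dc y t) g w.words))) =ᵐ[conf]
      fun w => -pointSum (fun c t w => φ t * jumpKernel x y f g c t w) w := by
    filter_upwards [ae_injective, hQ.prod_left_ae] with w hw hi
    exact integral_eq_pointSum hx hy hf.symm hg.symm hφ hφc hw hi
  -- Integrability of the sum over points comes without a separate estimate: up to sign it equals
  -- almost everywhere the inner integral of an integrable function.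
  have hP : Integrable (pointSum fun c t w => φ t * jumpKernel x y f g c t w) conf := by
    have := (hQ.integral_prod_right.congr hpt).neg
    simpa using this
  have e1 : ∫ p, (deriv φ p.1 * integrand f (x p.1) (y p.1) g p.2.words +
      (φ p.1 * integrand f (dc x p.1) (y p.1) g p.2.words +
        φ p.1 * integrand f (x p.1) (dc y p.1) g p.2.words)) ∂volume.prod conf =
      -∑ c, ∫ p, φ p.1 * jumpKernel x y f g c p.1 p.2 ∂volume.prod conf := by
    rw [integral_prod_symm _ hQ, integral_congr_ae hpt, integral_neg, integral_pointSum hk hP]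
  have e0 := (integral_add i0 (i1.add i2)).trans (congrArg _ (integral_add i1 i2))
  rw [← r0.integral_mul_form l0 hφ' hφc',
    ← r1.integral_mul_form l1 hφ.continuous hφc, ← r2.integral_mul_form l2 hφ.continuous hφc] at e0
  have e3 := e0.symm.trans e1
  have e2 : ∀ c, ∫ p, φ p.1 * jumpKernel x y f g c p.1 p.2 ∂volume.prod conf =
      ∫ t, φ t * jumpTerm x y f g c t := by
    intro c
    have j1 := ((rp c).locallyIntegrable_form (lp c)).integrable_smul_left_of_hasCompactSupport
      hφ.continuous hφc
    have j2 := ((rm c).locallyIntegrable_form (lm c)).integrable_smul_left_of_hasCompactSupport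
      hφ.continuous hφc
    simp only [smul_eq_mul] at j1 j2
    simp only [jumpKernel, jumpTerm, mul_sub]
    rw [integral_sub (ip c) (im c), integral_sub j1 j2,
      (rp c).integral_mul_form (lp c) hφ.continuous hφc,
      (rm c).integral_mul_form (lm c) hφ.continuous hφc]
  simp_rw [e2] at e3
  simp_rw [mul_comm _ (deriv φ _)]
  linear_combination -e3

theorem sum_univ_eleven (h : Fin 11 → ℂ) :
    ∑ c, h c = h 0 + h 1 + h 2 + h 3 + h 4 + h 5 + h 6 + h 7 + h 8 + h 9 + h 10 := by
  rw [Fin.sum_univ_castSucc, Fin.sum_univ_castSucc, Fin.sum_univ_castSucc, Fin.sum_univ_eight]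
  rfl

/-- The right side of the Itô formula. -/
def itoDeriv (x y : ℝ → Word → Word → Word → K →L[ℂ] K) (f g : Word → K) (t : ℝ) : ℂ :=
  (form f (dc x t) (y t) g + form f (x t) (dc y t) g + corr (-1) 1 x y t f g)
    + (form (annih t f) (jump 1 x t) (y t) g + form (annih t f) (x t) (jump 1 y t) g
      + corr 0 1 x y t (annih t f) g)
    + (form (annih t f) (jump 0 x t) (y t) (annih t g)
      + form (annih t f) (x t) (jump 0 y t) (annih t g)
      + corr 0 0 x y t (annih t f) (annih t g))
    + (form f (jump (-1) x t) (y t) (annih t g) + form f (x t) (jump (-1) y t) (annih t g)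
      + corr (-1) 0 x y t f (annih t g))

/-- Once each `D^i` is split into its two one-sided parts, the terms of the formula are those of the
eleven types. The chains meeting `π` give `a(t) f`, those meeting `ϱ` give `a(t) g`. -/
theorem itoDeriv_ae_eq (hx : IsC1 x) (hy : IsC1 y)
    (hxy : ∀ f g : Word → K, IsTest f → IsTest g → ∀ F ∈ family x, ∀ G ∈ family y,
      LocIntegrableInNorm (fun _ => f) F G fun _ => g)
    (hf : IsTest f) (hg : IsTest g) : ∀ᵐ t, itoDeriv x y f g t =
      form f (dc x t) (y t) g + form f (x t) (dc y t) g + ∑ c, jumpTerm x y f g c t := by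
  have h1 : ∀ (b d : Bool) (i : SignType), ∀ᵐ t,
      form (annihIf b f t) (jump i x t) (y t) (annihIf d g t) =
        form (annihIf b f t) (Rplus i x t) (y t) (annihIf d g t) -
        form (annihIf b f t) (Rminus i x t) (y t) (annihIf d g t) := fun b d i =>
    Regular.ae_form_sub_fst
      ⟨hf.isFamily_annihIf _, hx.right_isC0 i, hy.isC0, hg.isFamily_annihIf _⟩
      (locIntegrableInNorm_annihIf hx hy hxy hf hg b d
        (Or.inl (plusPart_mem_family (some i))) (Or.inl self_mem_family))
      ⟨hf.isFamily_annihIf _, hx.left_isC0 i, hy.isC0, hg.isFamily_annihIf _⟩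
      (locIntegrableInNorm_annihIf hx hy hxy hf hg b d
        (Or.inl (minusPart_mem_family (some i))) (Or.inl self_mem_family))
  have h2 : ∀ (b d : Bool) (i : SignType), ∀ᵐ t,
      form (annihIf b f t) (x t) (jump i y t) (annihIf d g t) =
        form (annihIf b f t) (x t) (Rplus i y t) (annihIf d g t) -
        form (annihIf b f t) (x t) (Rminus i y t) (annihIf d g t) := fun b d i =>
    Regular.ae_form_sub_snd
      ⟨hf.isFamily_annihIf _, hx.isC0, hy.right_isC0 i, hg.isFamily_annihIf _⟩
      (locIntegrableInNorm_annihIf hx hy hxy hf hg b d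
        (Or.inl self_mem_family) (Or.inl (plusPart_mem_family (some i))))
      ⟨hf.isFamily_annihIf _, hx.isC0, hy.left_isC0 i, hg.isFamily_annihIf _⟩
      (locIntegrableInNorm_annihIf hx hy hxy hf hg b d
        (Or.inl self_mem_family) (Or.inl (minusPart_mem_family (some i))))
  filter_upwards [h1 true false 1, h2 true false 1, h1 true true 0, h2 true true 0,
    h1 false true (-1), h2 false true (-1)] with t e1 e2 e3 e4 e5 e6
  simp only [annihIf, if_true, Bool.false_eq_true, if_false] at e1 e2 e3 e4 e5 e6
  rw [itoDeriv, e1, e2, e3, e4, e5, e6]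
  have t0 : jumpTerm x y f g 0 t = form (annih t f) (Rplus 1 x t) (y t) g -
      form (annih t f) (Rminus 1 x t) (y t) g := rfl
  have t1 : jumpTerm x y f g 1 t = form (annih t f) (x t) (Rplus 1 y t) g -
      form (annih t f) (x t) (Rminus 1 y t) g := rfl
  -- A chain from `π` straight to `ϱ` marks neither operator, so both one-sided values are `x` and
  -- `y` themselves.
  have t2 : jumpTerm x y f g 2 t = 0 := sub_self _
  have t3 : jumpTerm x y f g 3 t = corr 0 1 x y t (annih t f) g := rfl
  have t4 : jumpTerm x y f g 4 t = corr 0 0 x y t (annih t f) (annih t g) := rfl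
  have t5 : jumpTerm x y f g 5 t = form (annih t f) (Rplus 0 x t) (y t) (annih t g) -
      form (annih t f) (Rminus 0 x t) (y t) (annih t g) := rfl
  have t6 : jumpTerm x y f g 6 t = form (annih t f) (x t) (Rplus 0 y t) (annih t g) -
      form (annih t f) (x t) (Rminus 0 y t) (annih t g) := rfl
  have t7 : jumpTerm x y f g 7 t = corr (-1) 1 x y t f g := rfl
  have t8 : jumpTerm x y f g 8 t = corr (-1) 0 x y t f (annih t g) := rfl
  have t9 : jumpTerm x y f g 9 t = form f (Rplus (-1) x t) (y t) (annih t g) -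
      form f (Rminus (-1) x t) (y t) (annih t g) := rfl
  have t10 : jumpTerm x y f g 10 t = form f (x t) (Rplus (-1) y t) (annih t g) -
      form f (x t) (Rminus (-1) y t) (annih t g) := rfl
  rw [sum_univ_eleven, t0, t1, t2, t3, t4, t5, t6, t7, t8, t9, t10]
  ring

theorem locallyIntegrable_form_annihIf (hx : IsC1 x) (hy : IsC1 y)
    (hxy : ∀ f g : Word → K, IsTest f → IsTest g → ∀ F ∈ family x, ∀ G ∈ family y,
      LocIntegrableInNorm (fun _ => f) F G fun _ => g)
    (hf : IsTest f) (hg : IsTest g) (b d : Bool)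
    {F G : ℝ → Word → Word → Word → K →L[ℂ] K} (hF : F ∈ familyD x) (hG : G ∈ familyD y) :
    LocallyIntegrable fun t => form (annihIf b f t) (F t) (G t) (annihIf d g t) :=
  Regular.locallyIntegrable_form
    ⟨hf.isFamily_annihIf _, hx.isC0_of_memD hF, hy.isC0_of_memD hG, hg.isFamily_annihIf _⟩
    (locIntegrableInNorm_annihIf hx hy hxy hf hg b d hF hG)

theorem hasSchwartzDeriv_form (hx : IsC1 x) (hy : IsC1 y)
    (hxy : ∀ f g : Word → K, IsTest f → IsTest g → ∀ F ∈ family x, ∀ G ∈ family y,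
      LocIntegrableInNorm (fun _ => f) F G fun _ => g)
    (hf : IsTest f) (hg : IsTest g) :
    HasSchwartzDeriv (fun t => form f (x t) (y t) g) (itoDeriv x y f g) := by
  have hl := fun b d => fun {F G} =>
    locallyIntegrable_form_annihIf (F := F) (G := G) hx hy hxy hf hg b d
  have l0 := hl false false (Or.inl self_mem_family) (Or.inl self_mem_family)
  have l1 := hl false false (Or.inl dc_mem_family) (Or.inl self_mem_family)
  have l2 := hl false false (Or.inl self_mem_family) (Or.inl dc_mem_family)
  have l3 : ∀ c, LocallyIntegrable (jumpTerm x y f g c) := fun c =>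
    (hl _ _ (Or.inl (plusPart_mem_family _)) (Or.inl (plusPart_mem_family _))).sub
      (hl _ _ (Or.inl (minusPart_mem_family _)) (Or.inl (minusPart_mem_family _)))
  have l4 : LocallyIntegrable fun t => ∑ c, jumpTerm x y f g c t :=
    locallyIntegrable_finsetSum _ fun c _ => l3 c
  have hW := itoDeriv_ae_eq hx hy hxy hf hg
  refine ⟨l0, ?_, fun φ hφ hφc => ?_⟩
  · rw [locallyIntegrable_iff]
    intro C hC
    refine (((l1.add l2).add l4).integrableOn_isCompact hC).congr ?_
    exact ae_restrict_of_ae (hW.mono fun t ht => ht.symm)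
  · rw [neg_integral_form hx hy hxy hf hg hφ hφc]
    have j1 : Integrable fun t => φ t * form f (dc x t) (y t) g :=
      l1.integrable_smul_left_of_hasCompactSupport hφ.continuous hφc
    have j2 : Integrable fun t => φ t * form f (x t) (dc y t) g :=
      l2.integrable_smul_left_of_hasCompactSupport hφ.continuous hφc
    have j3 : ∀ c, Integrable fun t => φ t * jumpTerm x y f g c t := fun c =>
      (l3 c).integrable_smul_left_of_hasCompactSupport hφ.continuous hφc
    have e : ∫ t, itoDeriv x y f g t * φ t = ∫ t, ((φ t * form f (dc x t) (y t) g +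
        φ t * form f (x t) (dc y t) g) + ∑ c, φ t * jumpTerm x y f g c t) := by
      refine integral_congr_ae (hW.mono fun t ht => ?_)
      change itoDeriv x y f g t * φ t = (φ t * form f (dc x t) (y t) g +
        φ t * form f (x t) (dc y t) g) + ∑ c, φ t * jumpTerm x y f g c t
      rw [ht, ← Finset.mul_sum]
      ring
    have e' := (integral_add (j1.add j2) (integrable_finsetSum _ fun c _ => j3 c)).trans
      (congrArg₂ _ (integral_add j1 j2) (integral_finsetSum Finset.univ fun c _ => j3 c))
    exact (e.trans e').symm

end Main

end

end QIto

theorem theorem3p2p1 {K : Type*} [NormedAddCommGroup K] [InnerProductSpace ℂ K] [CompleteSpace K]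
    (x y : ℝ → QIto.Word → QIto.Word → QIto.Word → K →L[ℂ] K)
    (hx : QIto.IsC1 x) (hy : QIto.IsC1 y)
    (hxy : ∀ f g : QIto.Word → K, QIto.IsTest f → QIto.IsTest g →
      ∀ F ∈ QIto.family x, ∀ G ∈ QIto.family y,
        QIto.LocIntegrableInNorm (fun _ => f) F G (fun _ => g))
    (f g : QIto.Word → K) (hf : QIto.IsTest f) (hg : QIto.IsTest g) :
    (∀ F ∈ QIto.familyD x, ∀ G ∈ QIto.familyD y,
      QIto.LocIntegrableInNorm (fun _ => f) F G (fun _ => g) ∧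
      QIto.LocIntegrableInNorm (fun t => QIto.annih t f) F G (fun _ => g) ∧
      QIto.LocIntegrableInNorm (fun t => QIto.annih t f) F G (fun t => QIto.annih t g) ∧
      QIto.LocIntegrableInNorm (fun _ => f) F G (fun t => QIto.annih t g)) ∧
    QIto.HasSchwartzDeriv (fun t => QIto.form f (x t) (y t) g) (fun t =>
      (QIto.form f (QIto.dc x t) (y t) g + QIto.form f (x t) (QIto.dc y t) g
        + QIto.corr (-1) 1 x y t f g)
      + (QIto.form (QIto.annih t f) (QIto.jump 1 x t) (y t) g
        + QIto.form (QIto.annih t f) (x t) (QIto.jump 1 y t) g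
        + QIto.corr 0 1 x y t (QIto.annih t f) g)
      + (QIto.form (QIto.annih t f) (QIto.jump 0 x t) (y t) (QIto.annih t g)
        + QIto.form (QIto.annih t f) (x t) (QIto.jump 0 y t) (QIto.annih t g)
        + QIto.corr 0 0 x y t (QIto.annih t f) (QIto.annih t g))
      + (QIto.form f (QIto.jump (-1) x t) (y t) (QIto.annih t g)
        + QIto.form f (x t) (QIto.jump (-1) y t) (QIto.annih t g)
        + QIto.corr (-1) 0 x y t f (QIto.annih t g))) := by
  refine ⟨fun F hF G hG => ?_, QIto.hasSchwartzDeriv_form hx hy hxy hf hg⟩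
  have h := fun b d => QIto.locIntegrableInNorm_annihIf hx hy hxy hf hg b d hF hG
  exact ⟨h false false, h true false, h true true, h false true⟩
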